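/- \textbf{Setting.} Let $A$ be a finite-dimensional real alternative $^*$-algebra with unit $1\neq 0$ ($\mathbb R$ is identified with $\mathbb R\cdot 1$, and the involution $x\mapsto x^c$ is a real linear involutive anti-automorphism). Put $t(x)=x+x^c$, $n(x)=xx^c$, $\mathbb S_A=\{x\in A: t(x)=0,\ n(x)=1\}$, assumed non-empty, $\mathbb C_J=\mathbb R+\mathbb RJ$ for $J\in\mathbb S_A$, and $Q_A=\mathbb R\cup\{x\in A: t(x),n(x)\in\mathbb R,\ t(x)^2<4n(x)\}=\bigcup_{J\in\mathbb S_A}\mathbb C_J$. Assume that $A$ carries a norm with $\|x\|^2=n(x)$ for all $x\in Q_A$, and its Euclidean topology. A $^*$-algebra is \emph{nonsingular} if $n(x)=0$ implies $x=0$. For $E\subseteq\mathbb C$ let $\Omega_E=\{\alpha+\beta J:\alpha,\beta\in\mathbb R,\ \alpha+i\beta\in E,\ J\in\mathbb S_A\}$; sets of this form are called \emph{circular}, and ``open'' means open in $Q_A$. A \emph{slice domain} is an open set $\Omega_D$ with $D\subseteq\mathbb C$ open, connected, invariant under conjugation and meeting $\mathbb R$. Let $A_{\mathbb C}=A+\imath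 A$ be the complexification of $A$, with $\overline{x+\imath y}=x-\imath y$ and $(x+\imath y)^c=x^c+\imath y^c$. For $D\ne\emptyset$ invariant under conjugation, a \emph{stem function} is a map $F=F_1+\imath F_2:D\to A_{\mathbb C}$ with $F(\bar z)=\overline{F(z)}$; it induces the \emph{slice function} $f=\mathcal I(F):\Omega_D\to A$, $f(\alpha+\beta J)=F_1(\alpha+i\beta)+JF_2(\alpha+i\beta)$. The \emph{slice product} and the \emph{slice conjugate} are $\mathcal I(F)\cdot\mathcal I(G)=\mathcal I(FG)$ and $\mathcal I(F)^c=\mathcal I(F^c)$, where $F^c(z)=F(z)^c$. If $\Omega_D$ is open, $f=\mathcal I(F)$ is \emph{slice regular} if $F$ is $C^1$ and $\frac12\left(\frac{\partial F}{\partial\alpha}+\imath\frac{\partial F}{\partial\beta}\right)=0$ on $D$. For $x,y\in Q_A$ let $\sigma(x,y)=\tau(x,y)=\|x-y\|$ if $x,y$ lie in a common $\mathbb C_J$; otherwise let $\sigma(x,y)$ and $\tau(x,y)$ be $\sqrt{(\mathrm{Re}\,x-\mathrm{Re}\,y)^2+(\|\mathrm{Im}\,x\|\pm\|\mathrm{Im}\,y\|)^2}$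 with sign $+$ and $-$ respectively, where $\mathrm{Re}\,x=\frac12(x+x^c)$, $\mathrm{Im}\,x=\frac12(x-x^c)$. Let $\Sigma(y,0,R)=\{x\in Q_A:\tau(x,y)>0,\ \sigma(x,y)<R\}$. A point $y\in Q_A$ is a \emph{singularity} of a slice regular function $f$ on a circular open set $\Omega'$ if $\Sigma(y,0,R)\subseteq\Omega'$ for some $R>0$; then, for some such $R$, $f$ has on $\Sigma(y,0,R)$ a unique Laurent expansion $f(x)=\sum_{n\in\mathbb Z}(x-y)^{\bullet n}\cdot a_n$ with $a_n\in A$, powers and products being taken with respect to the slice product. The singularity $y$ is a \emph{pole} if $a_n=0$ for all but finitely many $n<0$, and it is \emph{removable} if $f$ extends to a slice regular function on a circular open set containing $y$. Let $\Omega$ be a non-empty circular open subset of $Q_A$. A \emph{semiregular function} on $\Omega$ is a slice regular function $f$ on a circular open subset $\Omega'\subseteq\Omega$ such that every point of $\Omega\setminus\Omega'$ is a pole or a removable singularity of $f$; two of them are identified if they agree on the intersection of their domains. \textbf{Theorem.} If $f,g$ are semiregular on $\Omega$, with domains $\Omega'$ and $\Omega''$, then so are $f+g$ and the slice product $f\cdot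 g$ (both with domain $\Omega'\cap\Omega''$), and $f^c$ and $rf$ for $r\in\mathbb R$ (both with domain $\Omega'$). These operations are well defined on the set of semiregular functions on $\Omega$. With $+$, $\cdot$ and scalar multiplication this set is a real alternative algebra, whose unit is the constant function $1\neq0$, and with $f\mapsto f^c$ it is a real $^*$-algebra. This $^*$-algebra is nonsingular if and only if $A$ is nonsingular and $\Omega$ is a union of slice domains. -/

import Mathlib

open Set Filter Topology

set_option linter.unusedSectionVars false

/-! ## Finite-dimensional real alternative *-algebras -/

/-- A unital, not necessarily associative ring with a compatible norm of the underlying additive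
group; no relation between the norm and the product is required. -/
class NormedNonAssocRing (A : Type*) extends Norm A, NonAssocRing A, MetricSpace A where
  dist_eq : ∀ x y : A, dist x y = ‖-x + y‖

instance (priority := 100) NormedNonAssocRing.toNormedAddCommGroup {A : Type*}
    [h : NormedNonAssocRing A] : NormedAddCommGroup A :=
  { h with }

/-- A (unital) ring is alternative if its associator is an alternating function. -/
def IsAlternative (A : Type*) [NonAssocRing A] : Prop :=
  ∀ x y : A, associator x x y = 0 ∧ associator y x x = 0

/-- A *-algebra is nonsingular if `n(x) = x x^c = 0` only for `x = 0`. -/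
def IsNonsingular (A : Type*) [NonAssocRing A] [Star A] : Prop :=
  ∀ x : A, x * star x = 0 → x = 0

namespace SliceAlg

section Cone

variable (A : Type*) [NormedNonAssocRing A] [NormedSpace ℝ A] [StarRing A]

/-- `𝕊_A = {x | t(x) = 0, n(x) = 1}`. -/
def imagUnits : Set A := {x | x + star x = 0 ∧ x * star x = 1}

/-- The quadratic cone `Q_A = ℝ ∪ {x | t(x) ∈ ℝ, n(x) ∈ ℝ, t(x)² < 4 n(x)}`. -/
def quadraticCone : Set A :=
  {x | ∃ r : ℝ, x = r • (1 : A)} ∪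
    {x | ∃ t n : ℝ, x + star x = t • (1 : A) ∧ x * star x = n • (1 : A) ∧ t ^ 2 < 4 * n}

/-- The norm of `A` satisfies `‖x‖² = n(x)` on the quadratic cone. -/
def NormCompatible : Prop :=
  ∀ x ∈ quadraticCone A, x * star x = (‖x‖ ^ 2) • (1 : A)

variable {A}

/-- The point `α + β J` for `z = α + i β`. -/
def toSlice (J : A) (z : ℂ) : A := z.re • (1 : A) + z.im • J

/-- The plane `ℂ_J`. -/
def slicePlane (J : A) : Set A := range (toSlice J)

/-- The circularization `Ω_E` of `E ⊆ ℂ`. -/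
def circularization (E : Set ℂ) : Set A :=
  {x | x ∈ quadraticCone A ∧ ∃ z ∈ E, ∃ J ∈ imagUnits A, x = toSlice J z}

def IsCircular (Ω : Set A) : Prop := ∃ E : Set ℂ, Ω = circularization E

/-- `Ω` is a subset of the quadratic cone, open in the relative topology. -/
def IsOpenInCone (Ω : Set A) : Prop := ∃ O : Set A, IsOpen O ∧ Ω = O ∩ quadraticCone A

def ConjInvariant (D : Set ℂ) : Prop := ∀ z ∈ D, star z ∈ D

/-- A slice domain: an open circular set `Ω_D` with `D` connected, invariant under conjugation and
intersecting the real line. -/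
def IsSliceDomain (Ω : Set A) : Prop :=
  IsOpenInCone Ω ∧ ∃ D : Set ℂ, IsOpen D ∧ IsConnected D ∧ ConjInvariant D ∧
    (∃ r : ℝ, (r : ℂ) ∈ D) ∧ Ω = circularization D

def IsUnionOfSliceDomains (Ω : Set A) : Prop :=
  ∃ S : Set (Set A), (∀ s ∈ S, IsSliceDomain s) ∧ Ω = ⋃₀ S

end Cone

/-! ## The complexified algebra `A_ℂ = A + ı A` -/

@[ext] structure Cplx (A : Type*) where
  re : A
  im : A

namespace Cplx

variable {A : Type*} [NonAssocRing A]

instance : Mul (Cplx A) :=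
  ⟨fun v w => ⟨v.re * w.re - v.im * w.im, v.re * w.im + v.im * w.re⟩⟩

instance : One (Cplx A) := ⟨⟨1, 0⟩⟩

instance : Zero (Cplx A) := ⟨⟨0, 0⟩⟩

/-- Complex conjugation `x + ı y ↦ x - ı y`. -/
def conj (w : Cplx A) : Cplx A := ⟨w.re, -w.im⟩

/-- The involution `x + ı y ↦ x^c + ı y^c`. -/
instance [Star A] : Star (Cplx A) := ⟨fun w => ⟨star w.re, star w.im⟩⟩

/-- The inclusion of `A` in `A_ℂ`. -/
def ofAlg (a : A) : Cplx A := ⟨a, 0⟩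

open Classical in
/-- The multiplicative inverse (unique when `A` is alternative), and `0` if there is none. -/
noncomputable def inv (w : Cplx A) : Cplx A :=
  if h : ∃ v, w * v = 1 ∧ v * w = 1 then h.choose else 0

def npow (w : Cplx A) : ℕ → Cplx A
  | 0 => 1
  | n + 1 => npow w n * w

noncomputable def zpow (w : Cplx A) : ℤ → Cplx A
  | Int.ofNat n => npow w n
  | Int.negSucc n => npow (inv w) (n + 1)

end Cplx

section Slice

variable {A : Type*} [NormedNonAssocRing A] [NormedSpace ℝ A] [StarRing A]

/-! ## Stem functions, slice functions, slice regular functions -/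

/-- `F` is a stem function on the nonempty conjugation invariant set `D`. -/
def IsStem (D : Set ℂ) (F : ℂ → Cplx A) : Prop :=
  D.Nonempty ∧ ConjInvariant D ∧ ∀ z ∈ D, F (star z) = (F z).conj

/-- `x + ı y ↦ x + J y`. -/
def evalAt (J : A) (w : Cplx A) : A := w.re + J * w.im

/-- On `Ω = Ω_D`, the function `f` is the slice function induced by the stem function `F` on `D`.
Only the values of `f` on `Ω` and of `F` on `D` matter. -/
def Induces (Ω : Set A) (D : Set ℂ) (F : ℂ → Cplx A) (f : A → A) : Prop :=
  Ω = circularization D ∧ IsStem D F ∧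
    ∀ z ∈ D, ∀ J ∈ imagUnits A, f (toSlice J z) = evalAt J (F z)

/-- On `Ω`, the function `h` is the slice product `f · g`. -/
def IsSliceProduct (Ω : Set A) (f g h : A → A) : Prop :=
  ∃ (D : Set ℂ) (F G : ℂ → Cplx A), Induces Ω D F f ∧ Induces Ω D G g ∧
    Induces Ω D (fun z => F z * G z) h

/-- On `Ω`, the function `h` is the slice conjugate `f^c`. -/
def IsSliceConj (Ω : Set A) (f h : A → A) : Prop :=
  ∃ (D : Set ℂ) (F : ℂ → Cplx A), Induces Ω D F f ∧ Induces Ω D (fun z => star (F z)) h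

/-- A stem function is continuously differentiable on `D`. -/
def IsC1 (D : Set ℂ) (F : ℂ → Cplx A) : Prop :=
  ContDiffOn ℝ 1 (fun z => (F z).re) D ∧ ContDiffOn ℝ 1 (fun z => (F z).im) D

/-- `∂F/∂z̄ = ½ (∂F/∂α + ı ∂F/∂β)`, computed in components. -/
noncomputable def dbar (F : ℂ → Cplx A) (z : ℂ) : Cplx A :=
  ⟨(1 / 2 : ℝ) • (fderiv ℝ (fun w => (F w).re) z 1 - fderiv ℝ (fun w => (F w).im) z Complex.I),
    (1 / 2 : ℝ) • (fderiv ℝ (fun w => (F w).im) z 1 + fderiv ℝ (fun w => (F w).re) z Complex.I)⟩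

/-- `f` is slice regular on the circular open set `Ω`. -/
def IsSliceRegular (Ω : Set A) (f : A → A) : Prop :=
  IsOpenInCone Ω ∧ ∃ (D : Set ℂ) (F : ℂ → Cplx A),
    Induces Ω D F f ∧ IsC1 D F ∧ ∀ z ∈ D, dbar F z = 0

/-! ## Laurent expansions and singularities -/

noncomputable def rePart (x : A) : A := (1 / 2 : ℝ) • (x + star x)

noncomputable def imPart (x : A) : A := (1 / 2 : ℝ) • (x - star x)

/-- `x` and `y` lie in the same plane `ℂ_J`. -/
def SamePlane (x y : A) : Prop := ∃ J ∈ imagUnits A, x ∈ slicePlane J ∧ y ∈ slicePlane J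

open Classical in
noncomputable def sigmaDist (x y : A) : ℝ :=
  if SamePlane x y then ‖x - y‖
  else √(‖rePart x - rePart y‖ ^ 2 + (‖imPart x‖ + ‖imPart y‖) ^ 2)

open Classical in
noncomputable def tauDist (x y : A) : ℝ :=
  if SamePlane x y then ‖x - y‖
  else √(‖rePart x - rePart y‖ ^ 2 + (‖imPart x‖ - ‖imPart y‖) ^ 2)

/-- `Σ(y, R₁, R₂) = {x ∈ Q_A | τ_A(x, y) > R₁, σ_A(x, y) < R₂}`. -/
def sigmaAnnulus (y : A) (R₁ R₂ : ℝ) : Set A :=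
  {x | x ∈ quadraticCone A ∧ R₁ < tauDist x y ∧ sigmaDist x y < R₂}

/-- `y ∈ Q_A` is a singularity for slice regular functions on `Ω`. -/
def IsSingularity (Ω : Set A) (y : A) : Prop :=
  y ∈ quadraticCone A ∧ ∃ R > 0, sigmaAnnulus y 0 R ⊆ Ω

/-- The stem function of `(x - y)^{• n} · a`, the slice product of the `n`-th slice power of the
binomial `x - y` (which is induced by `α + i β ↦ (α - y) + ı β`) and of the constant `a`. -/
noncomputable def laurentTerm (y a : A) (n : ℤ) (z : ℂ) : Cplx A :=
  Cplx.zpow ⟨z.re • (1 : A) - y, z.im • (1 : A)⟩ n * Cplx.ofAlg a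

/-- `f(x) = ∑_{n ∈ ℤ} (x - y)^{• n} · a_n` is the Laurent expansion of `f` at `y`: it is valid in
some `Σ(y, 0, R) ⊆ Ω` with `R > 0`. -/
def HasLaurentExpansion (Ω : Set A) (f : A → A) (y : A) (a : ℤ → A) : Prop :=
  ∃ R > 0, sigmaAnnulus y 0 R ⊆ Ω ∧
    ∀ z : ℂ, ∀ J ∈ imagUnits A, toSlice J z ∈ sigmaAnnulus y 0 R →
      HasSum (fun n : ℤ => evalAt J (laurentTerm y (a n) n z)) (f (toSlice J z))

/-- `y` is a pole for the slice regular function `f` on `Ω`: only finitely many negative powers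
occur in the Laurent expansion of `f` at `y`. -/
def IsPole (Ω : Set A) (f : A → A) (y : A) : Prop :=
  IsSingularity Ω y ∧ ∃ a : ℤ → A, HasLaurentExpansion Ω f y a ∧
    ∃ m : ℕ, ∀ k : ℕ, m < k → a (-(k : ℤ)) = 0

/-- `y` is a removable singularity for the slice regular function `f` on `Ω`: `f` extends to a
slice regular function on a circular open set containing `y`. -/
def IsRemovable (Ω : Set A) (f : A → A) (y : A) : Prop :=
  IsSingularity Ω y ∧ ∃ (V : Set A) (g : A → A), IsCircular V ∧ Ω ⊆ V ∧ y ∈ V ∧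
    IsSliceRegular V g ∧ EqOn g f Ω

/-! ## Semiregular functions -/

/-- A function `toFun`, slice regular on a circular open subset `dom` of `Ω`, all points of
`Ω \ dom` being poles or removable singularities. The values of `toFun` off `dom` are irrelevant. -/
structure SemiregularRep (Ω : Set A) where
  dom : Set A
  toFun : A → A
  dom_subset : dom ⊆ Ω
  circular : IsCircular dom
  regular : IsSliceRegular dom toFun
  sing : ∀ y ∈ Ω \ dom, IsPole dom toFun y ∨ IsRemovable dom toFun y

/-! ### Semiregular functions are identified when they agree on their common domain -/

section Aux

theorem star_imagUnit {J : A} (hJ : J ∈ imagUnits A) : star J = -J :=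
  (neg_eq_of_add_eq_zero_right hJ.1).symm

theorem trace_toSlice [StarModule ℝ A] {J : A} (hJ : J ∈ imagUnits A) (z : ℂ) :
    toSlice J z + star (toSlice J z) = (2 * z.re) • (1 : A) := by
  simp only [toSlice, star_add, star_smul, star_one, star_imagUnit hJ, star_trivial]
  module

theorem norm_toSlice [StarModule ℝ A] [IsScalarTower ℝ A A] [SMulCommClass ℝ A A] {J : A}
    (hJ : J ∈ imagUnits A) (z : ℂ) :
    toSlice J z * star (toSlice J z) = (z.re ^ 2 + z.im ^ 2) • (1 : A) := by
  have h : J * J = -1 := by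
    have := hJ.2
    rw [star_imagUnit hJ, mul_neg] at this
    rw [← this, neg_neg]
  simp only [toSlice, star_add, star_smul, star_one, star_imagUnit hJ, star_trivial, add_mul,
    mul_add, smul_mul_assoc, mul_smul_comm, mul_one, one_mul, mul_neg, h, smul_neg]
  module

theorem toSlice_mem_iff [Nontrivial A] [StarModule ℝ A] [IsScalarTower ℝ A A]
    [SMulCommClass ℝ A A] {J : A} (hJ : J ∈ imagUnits A) {D : Set ℂ} (hD : ConjInvariant D)
    (z : ℂ) (h : toSlice J z ∈ (circularization D : Set A)) : z ∈ D := by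
  obtain ⟨-, w, hw, K, hK, e⟩ := h
  have inj : ∀ r s : ℝ, r • (1 : A) = s • (1 : A) → r = s := fun r s h =>
    smul_left_injective ℝ (one_ne_zero (α := A)) h
  have h1 : 2 * z.re = 2 * w.re := inj _ _ (by rw [← trace_toSlice hJ, e, trace_toSlice hK])
  have h2 : z.re ^ 2 + z.im ^ 2 = w.re ^ 2 + w.im ^ 2 :=
    inj _ _ (by rw [← norm_toSlice hJ, e, norm_toSlice hK])
  have h1' : z.re = w.re := by linarith
  rw [h1'] at h2
  rcases sq_eq_sq_iff_eq_or_eq_neg.1 (add_left_cancel h2) with h3 | h3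
  · rwa [show z = w from Complex.ext h1' h3]
  · rw [show z = star w from Complex.ext (by simpa using h1') (by simpa using h3)]
    exact hD w hw

theorem continuous_toSlice (J : A) : Continuous (toSlice J) := by
  unfold toSlice
  fun_prop

theorem toSlice_mem_cone [StarModule ℝ A] [IsScalarTower ℝ A A] [SMulCommClass ℝ A A] {J : A}
    (hJ : J ∈ imagUnits A) (z : ℂ) : toSlice J z ∈ quadraticCone A := by
  by_cases h : z.im = 0
  · exact Or.inl ⟨z.re, by simp [toSlice, h]⟩
  · refine Or.inr ⟨_, _, trace_toSlice hJ z, norm_toSlice hJ z, ?_⟩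
    have : 0 < z.im ^ 2 := by positivity
    nlinarith

theorem eventually_mem [StarModule ℝ A] [IsScalarTower ℝ A A] [SMulCommClass ℝ A A] {J : A}
    (hJ : J ∈ imagUnits A) {Ω : Set A} (hΩ : IsOpenInCone Ω) {z : ℂ} (hz : toSlice J z ∈ Ω) :
    ∀ᶠ w in 𝓝 z, toSlice J w ∈ Ω := by
  obtain ⟨O, hO, rfl⟩ := hΩ
  filter_upwards [(hO.preimage (continuous_toSlice J)).mem_nhds hz.1] with w hw
  exact ⟨hw, toSlice_mem_cone hJ w⟩

/-- A slice regular function is continuous along each slice. -/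
theorem continuousAt_slice [Nontrivial A] [StarModule ℝ A] [IsScalarTower ℝ A A]
    [SMulCommClass ℝ A A] [FiniteDimensional ℝ A] {J : A} (hJ : J ∈ imagUnits A) {Ω : Set A}
    {f : A → A} (hf : IsSliceRegular Ω f) {z : ℂ} (hz : toSlice J z ∈ Ω) :
    ContinuousAt (fun w => f (toSlice J w)) z := by
  obtain ⟨hΩ, D, F, ⟨rfl, ⟨-, hD, -⟩, hF⟩, ⟨h1, h2⟩, -⟩ := hf
  have hev : ∀ᶠ w in 𝓝 z, w ∈ D := by
    filter_upwards [eventually_mem hJ hΩ hz] with w hw using toSlice_mem_iff hJ hD w hw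
  have hmul : Continuous fun x : A => J * x :=
    (LinearMap.mulLeft ℝ J).continuous_of_finiteDimensional
  have hc : ContinuousAt (fun w => evalAt J (F w)) z :=
    (h1.continuousOn.continuousAt hev).add
      (hmul.continuousAt.comp (h2.continuousOn.continuousAt hev))
  refine hc.congr ?_
  filter_upwards [hev] with w hw using (hF w hw J hJ).symm

theorem IsSingularity.eventually [Nontrivial A] [StarModule ℝ A] [IsScalarTower ℝ A A]
    [SMulCommClass ℝ A A] {J : A} (hJ : J ∈ imagUnits A) {Ω : Set A} {z : ℂ}
    (h : IsSingularity Ω (toSlice J z)) : ∀ᶠ w in 𝓝[≠] z, toSlice J w ∈ Ω := by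
  obtain ⟨-, R, hR, hsub⟩ := h
  have h1 : ∀ᶠ w in 𝓝[≠] z, toSlice J w ∈ Metric.ball (toSlice J z) R :=
    nhdsWithin_le_nhds
      ((Metric.isOpen_ball.preimage (continuous_toSlice J)).mem_nhds (Metric.mem_ball_self hR))
  filter_upwards [h1, self_mem_nhdsWithin] with w hw hne
  have hsame : SamePlane (toSlice J w) (toSlice J z) := ⟨J, hJ, ⟨w, rfl⟩, ⟨z, rfl⟩⟩
  refine hsub ⟨toSlice_mem_cone hJ w, ?_, ?_⟩
  · rw [tauDist, if_pos hsame, norm_pos_iff, sub_ne_zero]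
    intro e
    apply hne
    have h2 : toSlice J (w - z) = 0 := by
      have : toSlice J (w - z) = toSlice J w - toSlice J z := by
        simp only [toSlice, Complex.sub_re, Complex.sub_im]; module
      rw [this, e, sub_self]
    have h3 := norm_toSlice hJ (w - z)
    rw [h2, zero_mul, eq_comm, smul_eq_zero, or_iff_left one_ne_zero] at h3
    have h4 : (w - z).re = 0 := by nlinarith [sq_nonneg (w - z).re, sq_nonneg (w - z).im]
    have h5 : (w - z).im = 0 := by nlinarith [sq_nonneg (w - z).re, sq_nonneg (w - z).im]
    exact sub_eq_zero.1 (Complex.ext h4 h5)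
  · rw [sigmaDist, if_pos hsame, ← dist_eq_norm]
    exact hw

end Aux

section Quotient

variable [IsScalarTower ℝ A A] [SMulCommClass ℝ A A] [StarModule ℝ A]
  [FiniteDimensional ℝ A] [Nontrivial A]

instance semiregularSetoid (Ω : Set A) : Setoid (SemiregularRep Ω) where
  r f g := EqOn f.toFun g.toFun (f.dom ∩ g.dom)
  iseqv :=
    { refl := fun _ _ _ => rfl
      symm := fun h x hx => (h hx.symm).symm
      trans := by
        intro f g h hfg hgh x hx
        obtain ⟨E, hE⟩ := f.circular
        have hx' := hx.1
        rw [hE] at hx'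
        obtain ⟨hxQ, z, -, J, hJ, rfl⟩ := hx'
        have hg : ∀ᶠ w in 𝓝[≠] z, toSlice J w ∈ g.dom := by
          by_cases hxg : toSlice J z ∈ g.dom
          · exact nhdsWithin_le_nhds (eventually_mem hJ g.regular.1 hxg)
          · rcases g.sing _ ⟨f.dom_subset hx.1, hxg⟩ with hp | hp
            · exact hp.1.eventually hJ
            · exact hp.1.eventually hJ
        have hf : ∀ᶠ w in 𝓝[≠] z, toSlice J w ∈ f.dom :=
          nhdsWithin_le_nhds (eventually_mem hJ f.regular.1 hx.1)
        have hh : ∀ᶠ w in 𝓝[≠] z, toSlice J w ∈ h.dom :=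
          nhdsWithin_le_nhds (eventually_mem hJ h.regular.1 hx.2)
        have c1 := (continuousAt_slice hJ f.regular hx.1).tendsto.mono_left
          (nhdsWithin_le_nhds (s := {z}ᶜ))
        have c2 := (continuousAt_slice hJ h.regular hx.2).tendsto.mono_left
          (nhdsWithin_le_nhds (s := {z}ᶜ))
        refine tendsto_nhds_unique_of_eventuallyEq c1 c2 ?_
        filter_upwards [hf, hg, hh] with w h1 h2 h3
        exact (hfg ⟨h1, h2⟩).trans (hgh ⟨h2, h3⟩) }

/-- The set of semiregular functions on `Ω`. -/
def Semiregular (Ω : Set A) : Type _ := Quotient (semiregularSetoid Ω)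

/-- The semiregular function on `Ω` defined by a representative. -/
def SemiregularRep.toSemiregular {Ω : Set A} (f : SemiregularRep Ω) : Semiregular Ω :=
  Quotient.mk (semiregularSetoid Ω) f

end Quotient

end Slice

end SliceAlg

/-! Everything is moved from slice functions on the cone to stem functions on the plane. Two
opposite units `J`, `-J` suffice to recover the stem function `F` from `f` (`stemOf`). The slice
operations are pointwise operations on stem functions, and slice regularity is holomorphy of all
complex coordinates of `F`.

The analytic core is that semiregularity of `f` means meromorphy of `F` on the shadow of `Ω`. For
`y` in `ℂ_J` corresponding to `z₀`, the slice power `(x - y)^{•n} · a` restricts on `ℂ_J` to the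
ordinary `(z - z₀)^n a`, because `J (J a) = -a` in an alternative algebra makes `A` a complex space
under left multiplication by `ℂ_J`. Hence a pole at `α + βJ` gives a scalar Laurent series with
finite principal part along `ℂ_J`. The poles at `α + βJ` and `α - βJ` together make `F` meromorphic
(`isMeroAt_of_isPole_or_isRemovable`). Conversely, the scalar Laurent series of the coordinates of
`F`, with `i` replaced by `J`, add up to the slice expansion of `f` (`isPole_of_isMeroAt`).

A semiregular function is therefore the same as a germ of a meromorphic stem function along the
punctured neighborhoods of the points of the shadow (`stemGerm_injective`, `IsMeroStem.exists_rep`).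
Such germs are closed under the operations, so the set of semiregular functions inherits its
structure from the germs with values in `A_ℂ`, which is alternative because `A` is.

For nonsingularity, suppose first that `A` is nonsingular and that every point lies in a slice
domain. At real points `F` takes values in `A`, so `F F^c = 0` forces `F = 0` near a real point, and
the identity principle spreads this over the slice domain. Conversely, constants embed `A`. If a
component `C` of the shadow misses `ℝ`, it is disjoint from its conjugate, and the function equal to
`1 + ıJ` on `C`, `1 - ıJ` on the conjugate of `C` and `0` elsewhere is a nonzero stem function of
norm `1 + J² = 0`. -/

namespace SliceAlg

/-! ## Algebra of the complexification -/

namespace Cplx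

section Ring

variable {A : Type*} [NonAssocRing A]

instance : Add (Cplx A) := ⟨fun v w => ⟨v.re + w.re, v.im + w.im⟩⟩

instance : Neg (Cplx A) := ⟨fun w => ⟨-w.re, -w.im⟩⟩

instance : Sub (Cplx A) := ⟨fun v w => ⟨v.re - w.re, v.im - w.im⟩⟩

instance [SMul ℝ A] : SMul ℝ (Cplx A) := ⟨fun r w => ⟨r • w.re, r • w.im⟩⟩

@[simp] theorem re_zero : (0 : Cplx A).re = 0 := rfl
@[simp] theorem im_zero : (0 : Cplx A).im = 0 := rfl
@[simp] theorem re_one : (1 : Cplx A).re = 1 := rfl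
@[simp] theorem im_one : (1 : Cplx A).im = 0 := rfl
@[simp] theorem re_add (v w : Cplx A) : (v + w).re = v.re + w.re := rfl
@[simp] theorem im_add (v w : Cplx A) : (v + w).im = v.im + w.im := rfl
@[simp] theorem re_neg (w : Cplx A) : (-w).re = -w.re := rfl
@[simp] theorem im_neg (w : Cplx A) : (-w).im = -w.im := rfl
@[simp] theorem re_sub (v w : Cplx A) : (v - w).re = v.re - w.re := rfl
@[simp] theorem im_sub (v w : Cplx A) : (v - w).im = v.im - w.im := rfl
@[simp] theorem re_mul (v w : Cplx A) : (v * w).re = v.re * w.re - v.im * w.im := rfl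
@[simp] theorem im_mul (v w : Cplx A) : (v * w).im = v.re * w.im + v.im * w.re := rfl
@[simp] theorem re_smul [SMul ℝ A] (r : ℝ) (w : Cplx A) : (r • w).re = r • w.re := rfl
@[simp] theorem im_smul [SMul ℝ A] (r : ℝ) (w : Cplx A) : (r • w).im = r • w.im := rfl
@[simp] theorem re_star [Star A] (w : Cplx A) : (star w).re = star w.re := rfl
@[simp] theorem im_star [Star A] (w : Cplx A) : (star w).im = star w.im := rfl
@[simp] theorem re_conj (w : Cplx A) : w.conj.re = w.re := rfl
@[simp] theorem im_conj (w : Cplx A) : w.conj.im = -w.im := rfl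
@[simp] theorem re_ofAlg (a : A) : (ofAlg a).re = a := rfl
@[simp] theorem im_ofAlg (a : A) : (ofAlg a).im = 0 := rfl

instance : NonAssocRing (Cplx A) where
  add_assoc u v w := by ext <;> simp [add_assoc]
  zero_add w := by ext <;> simp
  add_zero w := by ext <;> simp
  add_comm v w := by ext <;> simp [add_comm]
  neg_add_cancel w := by ext <;> simp
  sub_eq_add_neg v w := by ext <;> simp [sub_eq_add_neg]
  nsmul := nsmulRec
  zsmul := zsmulRec
  left_distrib u v w := by ext <;> simp only [re_mul, im_mul, re_add, im_add, mul_add] <;> abel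
  right_distrib u v w := by ext <;> simp only [re_mul, im_mul, re_add, im_add, add_mul] <;> abel
  zero_mul w := by ext <;> simp
  mul_zero w := by ext <;> simp
  one_mul w := by ext <;> simp
  mul_one w := by ext <;> simp

instance [Module ℝ A] : Module ℝ (Cplx A) where
  one_smul w := by ext <;> simp
  mul_smul r s w := by ext <;> simp [mul_smul]
  smul_zero r := by ext <;> simp
  smul_add r v w := by ext <;> simp
  add_smul r s w := by ext <;> simp [add_smul]
  zero_smul w := by ext <;> simp

instance [Nontrivial A] : Nontrivial (Cplx A) :=
  ⟨⟨0, 1, fun h => zero_ne_one (congrArg Cplx.re h)⟩⟩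

theorem conj_add (v w : Cplx A) : (v + w).conj = v.conj + w.conj := by
  ext <;> simp [add_comm]

theorem conj_mul (v w : Cplx A) : (v * w).conj = v.conj * w.conj := by
  ext <;> simp [add_comm]

theorem conj_smul [Module ℝ A] (r : ℝ) (w : Cplx A) : (r • w).conj = r • w.conj := by
  ext <;> simp

instance [StarRing A] : StarRing (Cplx A) where
  star_involutive w := by ext <;> simp
  star_add v w := by ext <;> simp
  star_mul v w := by ext <;> simp [add_comm]

theorem conj_star [StarRing A] (w : Cplx A) : (star w).conj = star w.conj := by
  ext <;> simp

/-- Besides the alternative laws of `A`, the components of the associator contain only terms mixed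
in `v.re` and `v.im`; these cancel by the polarized laws `lin` and `lin'`. -/
theorem isAlternative (hA : IsAlternative A) : IsAlternative (Cplx A) := by
  have sq : ∀ x y : A, x * x * y = x * (x * y) := fun x y => sub_eq_zero.1 (hA x y).1
  have sq' : ∀ x y : A, y * x * x = y * (x * x) := fun x y => sub_eq_zero.1 (hA x y).2
  have lin : ∀ x y z : A, x * y * z + y * x * z = x * (y * z) + y * (x * z) := by
    intro x y z
    have h := sq (x + y) z
    simp only [add_mul, mul_add, sq x z, sq y z] at h
    rw [← sub_eq_zero] at h ⊢
    rw [← h]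
    abel
  have lin' : ∀ x y z : A, z * x * y + z * y * x = z * (x * y) + z * (y * x) := by
    intro x y z
    have h := sq' (x + y) z
    simp only [add_mul, mul_add, sq' x z, sq' y z] at h
    rw [← sub_eq_zero] at h ⊢
    rw [← h]
    abel
  intro v w
  have l1 := lin v.re v.im w.re
  have l2 := lin v.re v.im w.im
  have r1 := lin' v.re v.im w.re
  have r2 := lin' v.re v.im w.im
  rw [← sub_eq_zero] at l1 l2 r1 r2
  constructor <;> ext <;>
    simp only [associator, re_sub, im_sub, re_mul, im_mul, mul_add, add_mul, mul_sub, sub_mul, sq,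
      sq', re_zero, im_zero]
  · rw [← neg_eq_zero, ← l2]; abel
  · rw [← l1]; abel
  · rw [← neg_eq_zero, ← r2]; abel
  · rw [← r1]; abel

end Ring

end Cplx

/-! ### Arithmetic in the planes `ℂ_J` and in `ℂ_J + ı ℂ_J` -/

section Slice

variable {A : Type*} [NormedNonAssocRing A] [NormedSpace ℝ A] [StarRing A]

theorem imagUnit_mul_self {J : A} (hJ : J ∈ imagUnits A) : J * J = -1 := by
  have h := hJ.2
  rw [star_imagUnit hJ, mul_neg] at h
  rw [← h, neg_neg]

theorem neg_mem_imagUnits {J : A} (hJ : J ∈ imagUnits A) : -J ∈ imagUnits A := by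
  refine ⟨?_, ?_⟩
  · rw [star_neg, ← neg_add, hJ.1, neg_zero]
  · rw [star_neg, neg_mul_neg, hJ.2]

theorem imagUnit_mul_mul (hA : IsAlternative A) {J : A} (hJ : J ∈ imagUnits A) (x : A) :
    J * (J * x) = -x := by
  rw [← sub_eq_zero.1 (hA J x).1, imagUnit_mul_self hJ, neg_mul, one_mul]

theorem toSlice_neg (J : A) (z : ℂ) : toSlice (-J) z = toSlice J (star z) := by
  simp [toSlice]

theorem toSlice_add (J : A) (z w : ℂ) : toSlice J (z + w) = toSlice J z + toSlice J w := by
  simp only [toSlice, Complex.add_re, Complex.add_im]; module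

theorem toSlice_sub (J : A) (z w : ℂ) : toSlice J (z - w) = toSlice J z - toSlice J w := by
  simp only [toSlice, Complex.sub_re, Complex.sub_im]; module

theorem toSlice_one (J : A) : toSlice J 1 = 1 := by
  simp [toSlice]

theorem toSlice_zero (J : A) : toSlice J 0 = 0 := by
  simp [toSlice]

theorem toSlice_ofReal (J : A) (r : ℝ) : toSlice J (r : ℂ) = r • (1 : A) := by
  simp [toSlice]

theorem toSlice_I (J : A) : toSlice J Complex.I = J := by
  simp [toSlice]

section Algebra

variable [IsScalarTower ℝ A A] [SMulCommClass ℝ A A]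

/-- Left multiplication by `ℂ_J` makes `A` a complex vector space, although the product is not
associative. This is the only form of associativity available for an arbitrary third factor. -/
theorem toSlice_mul_mul (hA : IsAlternative A) {J : A} (hJ : J ∈ imagUnits A) (z w : ℂ) (x : A) :
    toSlice J z * (toSlice J w * x) = toSlice J (z * w) * x := by
  simp only [toSlice, add_mul, mul_add, smul_mul_assoc, mul_smul_comm, one_mul,
    imagUnit_mul_mul hA hJ, Complex.mul_re, Complex.mul_im]
  module

/-- The element of `ℂ_J + ı ℂ_J` whose images in `ℂ_J` and `ℂ_{-J}` correspond to `u` and `v`. -/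
noncomputable def bislice (J : A) (u v : ℂ) : Cplx A :=
  ⟨toSlice J ((u + v) / 2), toSlice J (-(Complex.I / 2) * (u - v))⟩

/-- `bislice J u v` is `u (1 - ıJ)/2 + v (1 + ıJ)/2`. The two idempotents are orthogonal, so
products are componentwise. The extra factor `w` replaces associativity in `bislice_inv`. -/
theorem bislice_mul_mul (hA : IsAlternative A) {J : A} (hJ : J ∈ imagUnits A) (u v u' v' : ℂ)
    (w : Cplx A) :
    bislice J u v * (bislice J u' v' * w) = bislice J (u * u') (v * v') * w := by
  have h1 : (u * u' + v * v') / 2 = (u + v) / 2 * ((u' + v') / 2) -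
      -(Complex.I / 2) * (u - v) * (-(Complex.I / 2) * (u' - v')) := by
    linear_combination ((u - v) * (u' - v') / 4) * Complex.I_sq
  have h2 : -(Complex.I / 2) * (u * u' - v * v') = (u + v) / 2 * (-(Complex.I / 2) * (u' - v')) +
      -(Complex.I / 2) * (u - v) * ((u' + v') / 2) := by ring
  ext <;>
    simp only [bislice, Cplx.re_mul, Cplx.im_mul, mul_add, mul_sub, toSlice_mul_mul hA hJ, h1, h2,
      toSlice_add, toSlice_sub, add_mul, sub_mul] <;>
    abel

theorem bislice_one (J : A) : bislice J 1 1 = 1 := by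
  ext <;> simp [bislice, toSlice_one, toSlice_zero]

theorem bislice_mul (hA : IsAlternative A) {J : A} (hJ : J ∈ imagUnits A) (u v u' v' : ℂ) :
    bislice J u v * bislice J u' v' = bislice J (u * u') (v * v') := by
  simpa using bislice_mul_mul hA hJ u v u' v' 1

theorem bislice_inv (hA : IsAlternative A) {J : A} (hJ : J ∈ imagUnits A) {u v : ℂ} (hu : u ≠ 0)
    (hv : v ≠ 0) : Cplx.inv (bislice J u v) = bislice J u⁻¹ v⁻¹ := by
  have ex : ∃ w, bislice J u v * w = 1 ∧ w * bislice J u v = 1 :=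
    ⟨bislice J u⁻¹ v⁻¹, by simp [bislice_mul hA hJ, hu, hv, bislice_one],
      by simp [bislice_mul hA hJ, hu, hv, bislice_one]⟩
  rw [Cplx.inv, dif_pos ex]
  -- `Cplx.inv` is some chosen inverse; multiplying it on the left by the explicit one identifies
  -- it.
  have h := bislice_mul_mul hA hJ u⁻¹ v⁻¹ u v ex.choose
  rwa [ex.choose_spec.1, mul_one, inv_mul_cancel₀ hu, inv_mul_cancel₀ hv, bislice_one, one_mul,
    eq_comm] at h

theorem bislice_npow (hA : IsAlternative A) {J : A} (hJ : J ∈ imagUnits A) (u v : ℂ) (n : ℕ) :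
    (bislice J u v).npow n = bislice J (u ^ n) (v ^ n) := by
  induction n with
  | zero => simp [Cplx.npow, bislice_one]
  | succ n ih => rw [Cplx.npow, ih, bislice_mul hA hJ, pow_succ, pow_succ]

theorem bislice_zpow (hA : IsAlternative A) {J : A} (hJ : J ∈ imagUnits A) {u v : ℂ} (hu : u ≠ 0)
    (hv : v ≠ 0) (n : ℤ) : (bislice J u v).zpow n = bislice J (u ^ n) (v ^ n) := by
  cases n with
  | ofNat n => simp [Cplx.zpow, bislice_npow hA hJ]
  | negSucc n => simp [Cplx.zpow, bislice_inv hA hJ hu hv, bislice_npow hA hJ]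

theorem evalAt_bislice_mul (hA : IsAlternative A) {J : A} (hJ : J ∈ imagUnits A) (u v : ℂ) (a : A) :
    evalAt J (bislice J u v * Cplx.ofAlg a) = toSlice J u * a := by
  have h : ∀ x, J * x = toSlice J Complex.I * x := fun x => by rw [toSlice_I]
  simp only [evalAt, bislice, Cplx.re_mul, Cplx.im_mul, Cplx.re_ofAlg, Cplx.im_ofAlg, mul_zero,
    sub_zero, zero_add]
  rw [h, toSlice_mul_mul hA hJ, ← add_mul, ← toSlice_add]
  congr 2
  linear_combination (-(u - v) / 2) * Complex.I_sq

theorem evalAt_neg_bislice_mul (hA : IsAlternative A) {J : A} (hJ : J ∈ imagUnits A) (u v : ℂ)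
    (a : A) : evalAt (-J) (bislice J u v * Cplx.ofAlg a) = toSlice J v * a := by
  have h : ∀ x, J * x = toSlice J Complex.I * x := fun x => by rw [toSlice_I]
  simp only [evalAt, bislice, Cplx.re_mul, Cplx.im_mul, Cplx.re_ofAlg, Cplx.im_ofAlg, mul_zero,
    sub_zero, zero_add]
  rw [neg_mul J, h, toSlice_mul_mul hA hJ, ← sub_eq_add_neg, ← sub_mul, ← toSlice_sub]
  congr 2
  linear_combination ((u - v) / 2) * Complex.I_sq

/-- The binomial `x - y` takes the value `z - z₀` on `ℂ_J` and `star z - z₀` at the mirror point.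
Both must be nonzero for `bislice_inv` to apply to its negative powers. -/
theorem binomial_eq_bislice (J : A) (z z₀ : ℂ) :
    (⟨z.re • (1 : A) - toSlice J z₀, z.im • (1 : A)⟩ : Cplx A) =
      bislice J (z - z₀) (star z - z₀) := by
  have h1 : (z - z₀ + (star z - z₀)) / 2 = (z.re : ℂ) - z₀ := by
    apply Complex.ext <;> simp; ring
  have h2 : -(Complex.I / 2) * (z - z₀ - (star z - z₀)) = (z.im : ℂ) := by
    apply Complex.ext <;> simp; ring
  ext
  · simp only [bislice, h1, toSlice_sub, toSlice_ofReal]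
  · simp only [bislice, h2, toSlice_ofReal]

theorem evalAt_laurentTerm (hA : IsAlternative A) {J : A} (hJ : J ∈ imagUnits A) {z z₀ : ℂ}
    (h1 : z ≠ z₀) (h2 : star z ≠ z₀) (a : A) (n : ℤ) :
    evalAt J (laurentTerm (toSlice J z₀) a n z) = toSlice J ((z - z₀) ^ n) * a := by
  rw [laurentTerm, binomial_eq_bislice, bislice_zpow hA hJ (sub_ne_zero.2 h1) (sub_ne_zero.2 h2),
    evalAt_bislice_mul hA hJ]

theorem evalAt_neg_laurentTerm (hA : IsAlternative A) {J : A} (hJ : J ∈ imagUnits A) {z z₀ : ℂ}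
    (h1 : z ≠ z₀) (h2 : star z ≠ z₀) (a : A) (n : ℤ) :
    evalAt (-J) (laurentTerm (toSlice J z₀) a n z) = toSlice J ((star z - z₀) ^ n) * a := by
  rw [laurentTerm, binomial_eq_bislice, bislice_zpow hA hJ (sub_ne_zero.2 h1) (sub_ne_zero.2 h2),
    evalAt_neg_bislice_mul hA hJ]

end Algebra

end Slice

/-! ## Holomorphic and meromorphic functions with values in the complexification -/

section Coordinates

variable {A : Type*} [NormedNonAssocRing A] [NormedSpace ℝ A]

/-- The complex linear extension of a real linear functional. -/
def Cplx.coord (φ : A →ₗ[ℝ] ℝ) (w : Cplx A) : ℂ := ⟨φ w.re, φ w.im⟩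

@[simp] theorem Cplx.re_coord (φ : A →ₗ[ℝ] ℝ) (w : Cplx A) : (w.coord φ).re = φ w.re := rfl

@[simp] theorem Cplx.im_coord (φ : A →ₗ[ℝ] ℝ) (w : Cplx A) : (w.coord φ).im = φ w.im := rfl

theorem Cplx.coord_add (φ : A →ₗ[ℝ] ℝ) (v w : Cplx A) :
    (v + w).coord φ = v.coord φ + w.coord φ := by
  apply Complex.ext <;> simp

theorem Cplx.coord_smul (φ : A →ₗ[ℝ] ℝ) (r : ℝ) (w : Cplx A) :
    (r • w).coord φ = r * w.coord φ := by
  apply Complex.ext <;> simp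

theorem Cplx.coord_zero (φ : A →ₗ[ℝ] ℝ) : (0 : Cplx A).coord φ = 0 := by
  apply Complex.ext <;> simp

theorem Cplx.eq_of_coord {v w : Cplx A} (h : ∀ φ : A →ₗ[ℝ] ℝ, v.coord φ = w.coord φ) :
    v = w := by
  have key : ∀ x y : A, (∀ φ : A →ₗ[ℝ] ℝ, φ x = φ y) → x = y := fun x y hxy =>
    sub_eq_zero.1 ((Module.forall_dual_apply_eq_zero_iff ℝ (x - y)).1 fun φ => by
      rw [map_sub, hxy φ, sub_self])
  ext
  · exact key _ _ fun φ => congrArg Complex.re (h φ)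
  · exact key _ _ fun φ => congrArg Complex.im (h φ)

/-- The involution of `A` as a real linear map. -/
def starLin [StarRing A] [StarModule ℝ A] : A →ₗ[ℝ] A where
  toFun := star
  map_add' := star_add
  map_smul' r x := by simp

theorem map_mul_eq_sum [IsScalarTower ℝ A A] [SMulCommClass ℝ A A] {ι : Type*} [Fintype ι]
    (b : Module.Basis ι ℝ A) (φ : A →ₗ[ℝ] ℝ) (x y : A) :
    φ (x * y) = ∑ i, ∑ j, φ (b i * b j) * (b.coord i x * b.coord j y) := by
  conv_lhs => rw [← b.sum_repr x, ← b.sum_repr y]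
  rw [Finset.sum_mul, map_sum]
  refine Finset.sum_congr rfl fun i _ => ?_
  rw [Finset.mul_sum, map_sum]
  refine Finset.sum_congr rfl fun j _ => ?_
  simp only [smul_mul_assoc, mul_smul_comm, map_smul, smul_eq_mul, Module.Basis.coord_apply]
  ring

/-- Coordinates of a product are bilinear in the coordinates of the factors, so holomorphy and
meromorphy of products reduce to scalar functions. -/
theorem Cplx.coord_mul [IsScalarTower ℝ A A] [SMulCommClass ℝ A A] {ι : Type*} [Fintype ι]
    (b : Module.Basis ι ℝ A) (φ : A →ₗ[ℝ] ℝ) (v w : Cplx A) :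
    (v * w).coord φ =
      ∑ i, ∑ j, (φ (b i * b j) : ℂ) * (v.coord (b.coord i) * w.coord (b.coord j)) := by
  apply Complex.ext
  · rw [Cplx.re_coord, Cplx.re_mul, map_sub, map_mul_eq_sum b φ v.re, map_mul_eq_sum b φ v.im]
    simp only [Complex.re_sum, Complex.ofReal_re, Complex.ofReal_im, zero_mul, sub_zero, Complex.mul_re, Cplx.re_coord, Cplx.im_coord,
      ← Finset.sum_sub_distrib, mul_sub]
  · rw [Cplx.im_coord, Cplx.im_mul, map_add, map_mul_eq_sum b φ v.re, map_mul_eq_sum b φ v.im]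
    simp only [Complex.im_sum, Complex.ofReal_re, Complex.ofReal_im, zero_mul, add_zero, Complex.mul_im, Cplx.re_coord, Cplx.im_coord,
      ← Finset.sum_add_distrib, mul_add]

/-- Holomorphy at a point of a function with values in the complexification. -/
def IsHolAt (F : ℂ → Cplx A) (z : ℂ) : Prop :=
  ∀ φ : A →ₗ[ℝ] ℝ, AnalyticAt ℂ (fun w => (F w).coord φ) z

/-- Meromorphy at a point of a function with values in the complexification. -/
def IsMeroAt (F : ℂ → Cplx A) (z : ℂ) : Prop :=
  ∀ φ : A →ₗ[ℝ] ℝ, MeromorphicAt (fun w => (F w).coord φ) z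

variable {F G : ℂ → Cplx A} {z : ℂ}

theorem IsHolAt.isMeroAt (h : IsHolAt F z) : IsMeroAt F z := fun φ => (h φ).meromorphicAt

theorem isHolAt_const (w : Cplx A) (z : ℂ) : IsHolAt (fun _ => w) z := fun _ => analyticAt_const

theorem IsHolAt.congr (h : IsHolAt F z) (e : F =ᶠ[𝓝 z] G) : IsHolAt G z := fun φ =>
  (h φ).congr (e.fun_comp (Cplx.coord φ))

theorem IsMeroAt.congr (h : IsMeroAt F z) (e : F =ᶠ[𝓝[≠] z] G) : IsMeroAt G z := fun φ =>
  (h φ).congr (e.fun_comp (Cplx.coord φ))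

theorem IsHolAt.add (hF : IsHolAt F z) (hG : IsHolAt G z) : IsHolAt (fun w => F w + G w) z :=
  fun φ => by simpa only [Cplx.coord_add] using (hF φ).fun_add (hG φ)

theorem IsMeroAt.add (hF : IsMeroAt F z) (hG : IsMeroAt G z) : IsMeroAt (fun w => F w + G w) z :=
  fun φ => by simpa only [Cplx.coord_add] using (hF φ).fun_add (hG φ)

theorem IsHolAt.smul (r : ℝ) (hF : IsHolAt F z) : IsHolAt (fun w => r • F w) z :=
  fun φ => by simpa only [Cplx.coord_smul] using analyticAt_const.fun_mul (hF φ)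

theorem IsMeroAt.smul (r : ℝ) (hF : IsMeroAt F z) : IsMeroAt (fun w => r • F w) z :=
  fun φ => by simpa only [Cplx.coord_smul] using (MeromorphicAt.const (r : ℂ) z).fun_mul (hF φ)

theorem IsHolAt.star [StarRing A] [StarModule ℝ A] (hF : IsHolAt F z) :
    IsHolAt (fun w => star (F w)) z := fun φ => hF (φ ∘ₗ starLin)

theorem IsMeroAt.star [StarRing A] [StarModule ℝ A] (hF : IsMeroAt F z) :
    IsMeroAt (fun w => star (F w)) z := fun φ => hF (φ ∘ₗ starLin)

section FiniteDimensional

variable [FiniteDimensional ℝ A]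

theorem IsHolAt.mul [IsScalarTower ℝ A A] [SMulCommClass ℝ A A] (hF : IsHolAt F z)
    (hG : IsHolAt G z) : IsHolAt (fun w => F w * G w) z := fun φ => by
  simp only [Cplx.coord_mul (Module.finBasis ℝ A)]
  exact Finset.analyticAt_fun_sum _ fun i _ => Finset.analyticAt_fun_sum _ fun j _ =>
    analyticAt_const.fun_mul ((hF _).fun_mul (hG _))

theorem IsMeroAt.mul [IsScalarTower ℝ A A] [SMulCommClass ℝ A A] (hF : IsMeroAt F z)
    (hG : IsMeroAt G z) : IsMeroAt (fun w => F w * G w) z := fun φ => by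
  simp only [Cplx.coord_mul (Module.finBasis ℝ A)]
  exact MeromorphicAt.fun_sum fun i _ => MeromorphicAt.fun_sum fun j _ =>
    (MeromorphicAt.const _ z).fun_mul ((hF _).fun_mul (hG _))

/-- `Cplx.coord` as a continuous real linear map on pairs. -/
noncomputable def coordCLM (φ : A →ₗ[ℝ] ℝ) : A × A →L[ℝ] ℂ :=
  LinearMap.toContinuousLinearMap
    { toFun := fun p => Cplx.coord φ ⟨p.1, p.2⟩
      map_add' := fun p q => by apply Complex.ext <;> simp
      map_smul' := fun r p => by apply Complex.ext <;> simp }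

theorem coordCLM_apply (φ : A →ₗ[ℝ] ℝ) (x y : A) : coordCLM φ (x, y) = Cplx.coord φ ⟨x, y⟩ := rfl

theorem hasFDerivAt_coord (φ : A →ₗ[ℝ] ℝ) (h1 : DifferentiableAt ℝ (fun w => (F w).re) z)
    (h2 : DifferentiableAt ℝ (fun w => (F w).im) z) :
    HasFDerivAt (fun w => (F w).coord φ) ((coordCLM φ).comp
      ((fderiv ℝ (fun w => (F w).re) z).prod (fderiv ℝ (fun w => (F w).im) z))) z :=
  (coordCLM φ).hasFDerivAt.comp z (h1.hasFDerivAt.prodMk h2.hasFDerivAt)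

/-- Read through a complex linear coordinate, `dbar F z = 0` becomes the Cauchy-Riemann equations.
-/
theorem differentiableAt_coord_iff (φ : A →ₗ[ℝ] ℝ)
    (h1 : DifferentiableAt ℝ (fun w => (F w).re) z)
    (h2 : DifferentiableAt ℝ (fun w => (F w).im) z) :
    DifferentiableAt ℂ (fun w => (F w).coord φ) z ↔ (dbar F z).coord φ = 0 := by
  rw [differentiableAt_complex_iff_differentiableAt_real,
    and_iff_right (hasFDerivAt_coord φ h1 h2).differentiableAt, (hasFDerivAt_coord φ h1 h2).fderiv]
  simp only [ContinuousLinearMap.comp_apply, ContinuousLinearMap.prod_apply, coordCLM_apply,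
    Complex.ext_iff, Cplx.re_coord, Cplx.im_coord, smul_eq_mul, Complex.mul_re, Complex.mul_im,
    Complex.I_re, Complex.I_im, dbar, map_smul, map_sub, map_add, Complex.zero_re, Complex.zero_im]
  constructor <;> rintro ⟨h, h'⟩ <;> constructor <;> linarith

theorem IsC1.isHolAt {D : Set ℂ} (hD : IsOpen D) (h : IsC1 D F) (hF : ∀ z ∈ D, dbar F z = 0)
    (hz : z ∈ D) : IsHolAt F z := by
  intro φ
  refine DifferentiableOn.analyticAt (s := D) (fun w hw => ?_) (hD.mem_nhds hz)
  refine DifferentiableAt.differentiableWithinAt ((differentiableAt_coord_iff φ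
    ((h.1.differentiableOn one_ne_zero).differentiableAt (hD.mem_nhds hw))
    ((h.2.differentiableOn one_ne_zero).differentiableAt (hD.mem_nhds hw))).2 ?_)
  rw [hF w hw, Cplx.coord_zero]

theorem isC1_of_isHolAt {D : Set ℂ} (h : ∀ z ∈ D, IsHolAt F z) : IsC1 D F := by
  have b := Module.finBasis ℝ A
  constructor
  · have e : (fun z => (F z).re) = fun z => ∑ i, ((F z).coord (b.coord i)).re • b i := by
      funext z; simp [b.sum_repr]
    rw [e]
    intro z hz
    refine ContDiffWithinAt.sum fun i _ => ContDiffWithinAt.smul ?_ contDiffWithinAt_const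
    have hi : ContDiffAt ℝ 1 (fun w => (F w).coord (b.coord i)) z :=
      (h z hz _).contDiffAt.restrict_scalars ℝ
    exact (Complex.reCLM.contDiff.contDiffAt.comp z hi).contDiffWithinAt
  · have e : (fun z => (F z).im) = fun z => ∑ i, ((F z).coord (b.coord i)).im • b i := by
      funext z; simp [b.sum_repr]
    rw [e]
    intro z hz
    refine ContDiffWithinAt.sum fun i _ => ContDiffWithinAt.smul ?_ contDiffWithinAt_const
    have hi : ContDiffAt ℝ 1 (fun w => (F w).coord (b.coord i)) z :=
      (h z hz _).contDiffAt.restrict_scalars ℝ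
    exact (Complex.imCLM.contDiff.contDiffAt.comp z hi).contDiffWithinAt

theorem dbar_eq_zero_of_isHolAt {D : Set ℂ} (hD : IsOpen D) (h : ∀ z ∈ D, IsHolAt F z)
    (hz : z ∈ D) : dbar F z = 0 := by
  have hc := isC1_of_isHolAt h
  refine Cplx.eq_of_coord fun φ => ?_
  rw [Cplx.coord_zero]
  exact (differentiableAt_coord_iff φ
    ((hc.1.differentiableOn one_ne_zero).differentiableAt (hD.mem_nhds hz))
    ((hc.2.differentiableOn one_ne_zero).differentiableAt (hD.mem_nhds hz))).1
    (h z hz φ).differentiableAt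

end FiniteDimensional

end Coordinates

/-! ## Geometry of the quadratic cone -/

section Geometry

variable {A : Type*} [NormedNonAssocRing A] [NormedSpace ℝ A] [StarRing A]
  [IsScalarTower ℝ A A] [SMulCommClass ℝ A A] [StarModule ℝ A]

theorem exists_toSlice_eq (hS : (imagUnits A).Nonempty) {x : A} (hx : x ∈ quadraticCone A) :
    ∃ J ∈ imagUnits A, ∃ z : ℂ, x = toSlice J z := by
  rcases hx with ⟨r, rfl⟩ | ⟨t, n, ht, hn, h⟩
  · obtain ⟨J, hJ⟩ := hS
    exact ⟨J, hJ, r, (toSlice_ofReal J r).symm⟩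
  · have hpos : 0 < n - t ^ 2 / 4 := by linarith
    -- From `x² = t x - n` one gets `(x - t/2)² = -β²`, so `β⁻¹ (x - t/2)` is an imaginary unit.
    set β := √(n - t ^ 2 / 4) with hβ
    have hβ0 : 0 < β := Real.sqrt_pos.2 hpos
    have hβ2 : β * β = n - t ^ 2 / 4 := Real.mul_self_sqrt hpos.le
    have hst : star x = t • (1 : A) - x := by rw [← ht]; abel
    have hs : star (β⁻¹ • (x - (t / 2) • (1 : A))) = -(β⁻¹ • (x - (t / 2) • (1 : A))) := by
      simp only [star_smul, star_sub, star_one, star_trivial, hst]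
      module
    have hxx : x * x = t • x - n • (1 : A) := by
      rw [← hn, hst, mul_sub, mul_smul_comm, mul_one]; abel
    refine ⟨β⁻¹ • (x - (t / 2) • (1 : A)), ⟨by rw [hs, add_neg_cancel], ?_⟩, ⟨t / 2, β⟩, ?_⟩
    · rw [hs]
      simp only [mul_neg, smul_mul_assoc, mul_smul_comm, sub_mul, mul_sub, one_mul, mul_one, hxx]
      have : ((β * β)⁻¹ * (n - t ^ 2 / 4)) • (1 : A) = 1 := by
        rw [← hβ2, inv_mul_cancel₀ (mul_pos hβ0 hβ0).ne', one_smul]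
      refine Eq.trans ?_ this
      rw [mul_inv]
      module
    · simp only [toSlice, smul_smul, mul_inv_cancel₀ hβ0.ne', one_smul]
      abel

theorem toSlice_mem_circularization_of_mem {D : Set ℂ} {J : A} (hJ : J ∈ imagUnits A) {z : ℂ}
    (hz : z ∈ D) : toSlice J z ∈ (circularization D : Set A) :=
  ⟨toSlice_mem_cone hJ z, z, hz, J, hJ, rfl⟩

theorem rePart_toSlice {J : A} (hJ : J ∈ imagUnits A) (z : ℂ) :
    rePart (toSlice J z) = z.re • (1 : A) := by
  rw [rePart, trace_toSlice hJ]
  module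

theorem imPart_toSlice {J : A} (hJ : J ∈ imagUnits A) (z : ℂ) :
    imPart (toSlice J z) = z.im • J := by
  simp only [imPart, toSlice, star_add, star_smul, star_one, star_imagUnit hJ, star_trivial]
  module

variable [Nontrivial A]

theorem smul_one_injective {r s : ℝ} (h : r • (1 : A) = s • (1 : A)) : r = s :=
  smul_left_injective ℝ (one_ne_zero (α := A)) h

theorem norm_toSlice_eq (hN : NormCompatible A) {J : A} (hJ : J ∈ imagUnits A) (z : ℂ) :
    ‖toSlice J z‖ = ‖z‖ := by
  have h := hN _ (toSlice_mem_cone hJ z)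
  rw [norm_toSlice hJ] at h
  rw [← sq_eq_sq₀ (norm_nonneg _) (norm_nonneg _), ← smul_one_injective h, Complex.sq_norm,
    Complex.normSq_apply]
  ring

theorem norm_imPart_toSlice (hN : NormCompatible A) {J : A} (hJ : J ∈ imagUnits A) (z : ℂ) :
    ‖imPart (toSlice J z)‖ = |z.im| := by
  have h := norm_toSlice_eq hN hJ (z.im * Complex.I)
  rw [imPart_toSlice hJ]
  simpa [toSlice] using h

/-- Trace and norm recover `α` and `β²`. The only ambiguity is `(z, J) ∼ (star z, -J)`, and an
arbitrary unit at real points. -/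
theorem toSlice_eq_cases {J K : A} (hJ : J ∈ imagUnits A) (hK : K ∈ imagUnits A) {z w : ℂ}
    (e : toSlice J z = toSlice K w) :
    (z = w ∧ (z.im = 0 ∨ J = K)) ∨ (z = star w ∧ (z.im = 0 ∨ J = -K)) := by
  have h1 : z.re = w.re := by
    have : 2 * z.re = 2 * w.re := smul_one_injective (A := A) (by
      rw [← trace_toSlice hJ, e, trace_toSlice hK])
    linarith
  have h2 : z.re ^ 2 + z.im ^ 2 = w.re ^ 2 + w.im ^ 2 :=
    smul_one_injective (A := A) (by rw [← norm_toSlice hJ, e, norm_toSlice hK])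
  have h3 : z.im • J = w.im • K := by
    simpa [toSlice, h1] using e
  rw [h1] at h2
  rcases sq_eq_sq_iff_eq_or_eq_neg.1 (add_left_cancel h2) with h4 | h4
  · refine Or.inl ⟨Complex.ext h1 h4, or_iff_not_imp_left.2 fun h0 => ?_⟩
    rw [← h4] at h3
    exact smul_right_injective A h0 h3
  · refine Or.inr ⟨Complex.ext (by simpa using h1) (by simpa using h4),
      or_iff_not_imp_left.2 fun h0 => ?_⟩
    rw [show w.im = -z.im by rw [h4, neg_neg], neg_smul, ← smul_neg] at h3
    exact smul_right_injective A h0 h3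

theorem toSlice_mem_circularization {J : A} (hJ : J ∈ imagUnits A) {D : Set ℂ}
    (hD : ConjInvariant D) {z : ℂ} : toSlice J z ∈ (circularization D : Set A) ↔ z ∈ D :=
  ⟨toSlice_mem_iff hJ hD z, toSlice_mem_circularization_of_mem hJ⟩

theorem samePlane_toSlice {J : A} (hJ : J ∈ imagUnits A) (z w : ℂ) :
    SamePlane (toSlice J z) (toSlice J w) := ⟨J, hJ, ⟨z, rfl⟩, ⟨w, rfl⟩⟩

theorem toSlice_mem_sigmaAnnulus (hN : NormCompatible A) {J : A} (hJ : J ∈ imagUnits A)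
    {z w : ℂ} {R : ℝ} :
    toSlice J z ∈ sigmaAnnulus (toSlice J w) 0 R ↔ 0 < ‖z - w‖ ∧ ‖z - w‖ < R := by
  have h := samePlane_toSlice hJ z w
  rw [sigmaAnnulus, mem_ofPred_eq, tauDist, sigmaDist, if_pos h, if_pos h, ← toSlice_sub,
    norm_toSlice_eq hN hJ, and_iff_right (toSlice_mem_cone hJ z)]

/-- Small punctured neighborhoods of a non real point are contained in its plane. -/
theorem mem_sigmaAnnulus_cases (hN : NormCompatible A) {J K : A} (hJ : J ∈ imagUnits A)
    (hK : K ∈ imagUnits A) {z w : ℂ} {R : ℝ} (hw : w.im ≠ 0) (hR : R ≤ |w.im|)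
    (h : toSlice K z ∈ sigmaAnnulus (toSlice J w) 0 R) :
    (K = J ∧ 0 < ‖z - w‖ ∧ ‖z - w‖ < R) ∨ (K = -J ∧ 0 < ‖star z - w‖ ∧ ‖star z - w‖ < R) := by
  by_cases hp : SamePlane (toSlice K z) (toSlice J w)
  · have hu : ∃ u, toSlice K z = toSlice J u := by
      obtain ⟨L, hL, ⟨u, hu⟩, ⟨v, hv⟩⟩ := hp
      rcases toSlice_eq_cases hL hJ hv with ⟨h1, h2⟩ | ⟨h1, h2⟩
      · rw [h1, or_iff_right hw] at h2
        exact ⟨u, by rw [← hu, h2]⟩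
      · have : v.im ≠ 0 := by simpa [h1] using hw
        rw [or_iff_right this] at h2
        exact ⟨star u, by rw [← hu, h2, toSlice_neg]⟩
    obtain ⟨u, hu⟩ := hu
    rw [hu, toSlice_mem_sigmaAnnulus hN hJ] at h
    have hu0 : u.im ≠ 0 := by
      intro h0
      have := Complex.abs_im_le_norm (u - w)
      rw [Complex.sub_im, h0, zero_sub, abs_neg] at this
      linarith [h.2]
    rcases toSlice_eq_cases hK hJ hu with ⟨h1, h2⟩ | ⟨h1, h2⟩
    · rw [h1, or_iff_right hu0] at h2
      exact Or.inl ⟨h2, h1 ▸ h⟩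
    · have : z.im ≠ 0 := by simpa [h1] using hu0
      rw [or_iff_right this] at h2
      refine Or.inr ⟨h2, ?_⟩
      rwa [h1, star_star]
  · exfalso
    -- Between different planes the norms of the imaginary parts add, so `σ` is at least `|w.im| ≥
    -- R`.
    have h2 := h.2.2
    rw [sigmaDist, if_neg hp, norm_imPart_toSlice hN hJ, norm_imPart_toSlice hN hK] at h2
    have : |w.im| ≤ √(‖rePart (toSlice K z) - rePart (toSlice J w)‖ ^ 2 +
        (|z.im| + |w.im|) ^ 2) := by
      apply Real.le_sqrt_of_sq_le
      nlinarith [abs_nonneg z.im, abs_nonneg w.im,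
        sq_nonneg ‖rePart (toSlice K z) - rePart (toSlice J w)‖]
    linarith

/-! ### The planar shadow of a circular set -/

/-- The set of all `α + i β` such that some `α + β J` lies in `Ω`. -/
def shadow (Ω : Set A) : Set ℂ := {z | ∃ J ∈ imagUnits A, toSlice J z ∈ Ω}

theorem conjInvariant_shadow (Ω : Set A) : ConjInvariant (shadow Ω) := by
  rintro z ⟨J, hJ, hz⟩
  exact ⟨-J, neg_mem_imagUnits hJ, by rwa [toSlice_neg, star_star]⟩

theorem shadow_circularization (hS : (imagUnits A).Nonempty) {D : Set ℂ} (hD : ConjInvariant D) :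
    shadow (circularization D : Set A) = D := by
  ext z
  refine ⟨fun ⟨J, hJ, h⟩ => toSlice_mem_iff hJ hD z h, fun h => ?_⟩
  obtain ⟨J, hJ⟩ := hS
  exact ⟨J, hJ, toSlice_mem_circularization_of_mem hJ h⟩

/-- The set `E` defining a circular set need not be symmetric; the shadow is its union with its
conjugate, which has the same circularization since `-J` is again a unit. -/
theorem IsCircular.circularization_shadow {Ω : Set A} (h : IsCircular Ω) :
    circularization (shadow Ω) = Ω := by
  obtain ⟨E, rfl⟩ := h
  ext x
  constructor
  · rintro ⟨-, z, ⟨K, hK, -, w, hw, L, hL, e⟩, J, hJ, rfl⟩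
    rcases toSlice_eq_cases hK hL e with ⟨rfl, -⟩ | ⟨rfl, -⟩
    · exact toSlice_mem_circularization_of_mem hJ hw
    · rw [← toSlice_neg]
      exact toSlice_mem_circularization_of_mem (neg_mem_imagUnits hJ) hw
  · rintro ⟨hx, z, hz, J, hJ, rfl⟩
    exact toSlice_mem_circularization_of_mem hJ ⟨J, hJ, toSlice_mem_circularization_of_mem hJ hz⟩

theorem IsCircular.toSlice_mem {Ω : Set A} (h : IsCircular Ω) {J : A} (hJ : J ∈ imagUnits A)
    {z : ℂ} : toSlice J z ∈ Ω ↔ z ∈ shadow Ω := by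
  conv_lhs => rw [← h.circularization_shadow]
  exact toSlice_mem_circularization hJ (conjInvariant_shadow Ω)

theorem IsOpenInCone.isOpen_shadow {Ω : Set A} (h : IsOpenInCone Ω) : IsOpen (shadow Ω) := by
  rw [isOpen_iff_mem_nhds]
  rintro z ⟨J, hJ, hz⟩
  filter_upwards [eventually_mem hJ h hz] with w hw using ⟨J, hJ, hw⟩

/-- The map `x ↦ Re x + i ‖Im x‖` is continuous and sends `α + βJ` to `α + i|β|`. By symmetry of
`D`, the circularization is the trace on the cone of the preimage of `D`. -/
theorem isOpenInCone_circularization [FiniteDimensional ℝ A] (hS : (imagUnits A).Nonempty)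
    (hN : NormCompatible A) {D : Set ℂ} (hD : IsOpen D) (hc : ConjInvariant D) :
    IsOpenInCone (circularization D : Set A) := by
  -- `φ` serves to read the real number off an element of `ℝ · 1`.
  obtain ⟨φ, hφ⟩ : ∃ φ : A →ₗ[ℝ] ℝ, φ 1 = 1 := by
    by_contra! h
    refine one_ne_zero (α := A) ((Module.forall_dual_apply_eq_zero_iff ℝ (1 : A)).1 fun ψ => ?_)
    by_contra h0
    exact h ((ψ 1)⁻¹ • ψ) (by simp [inv_mul_cancel₀ h0])
  have cs : Continuous (star : A → A) := (starLin (A := A)).continuous_of_finiteDimensional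
  have cφ : Continuous φ := φ.continuous_of_finiteDimensional
  have c1 : Continuous fun x : A => φ (rePart x) := by unfold rePart; fun_prop
  have c2 : Continuous fun x : A => ‖imPart x‖ := by unfold imPart; fun_prop
  have c : Continuous fun x : A => (φ (rePart x) : ℂ) + (‖imPart x‖ : ℂ) * Complex.I :=
    (Complex.continuous_ofReal.comp c1).add ((Complex.continuous_ofReal.comp c2).mul_const _)
  have key : ∀ J ∈ imagUnits A, ∀ z, ((φ (rePart (toSlice J z)) : ℂ) +
      (‖imPart (toSlice J z)‖ : ℂ) * Complex.I ∈ D ↔ z ∈ D) := by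
    intro J hJ z
    rw [rePart_toSlice hJ, norm_imPart_toSlice hN hJ, map_smul, hφ, smul_eq_mul, mul_one]
    rcases abs_choice z.im with h | h
    · rw [h, Complex.re_add_im]
    · have e : (z.re : ℂ) + ((|z.im| : ℝ) : ℂ) * Complex.I = star z := by
        rw [h]; apply Complex.ext <;> simp
      rw [e]
      exact ⟨fun hz => by simpa using hc _ hz, fun hz => hc _ hz⟩
  refine ⟨_, hD.preimage c, ?_⟩
  ext x
  constructor
  · rintro ⟨hx, z, hz, J, hJ, rfl⟩
    exact ⟨(key J hJ z).2 hz, hx⟩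
  · rintro ⟨hx, hq⟩
    obtain ⟨J, hJ, z, rfl⟩ := exists_toSlice_eq hS hq
    exact toSlice_mem_circularization_of_mem hJ ((key J hJ z).1 hx)

theorem circularization_inter {D D' : Set ℂ} (hD' : ConjInvariant D') :
    (circularization D ∩ circularization D' : Set A) = circularization (D ∩ D') := by
  ext x
  constructor
  · rintro ⟨⟨hx, z, hz, J, hJ, rfl⟩, h⟩
    exact toSlice_mem_circularization_of_mem hJ ⟨hz, toSlice_mem_iff hJ hD' z h⟩
  · rintro ⟨hx, z, hz, J, hJ, rfl⟩
    exact ⟨toSlice_mem_circularization_of_mem hJ hz.1, toSlice_mem_circularization_of_mem hJ hz.2⟩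

/-! ### Stem functions are determined by the slice functions they induce -/

/-- The stem function recovered from the values on `ℂ_J` of the slice function. -/
noncomputable def stemOf (J : A) (f : A → A) (z : ℂ) : Cplx A :=
  ⟨(1 / 2 : ℝ) • (f (toSlice J z) + f (toSlice J (star z))),
    -(1 / 2 : ℝ) • (J * (f (toSlice J z) - f (toSlice J (star z))))⟩

/-- The values at `±J` are `F₁ ± J F₂`; half their sum is `F₁`, and applying `J` to half their
difference gives `-F₂`. -/
theorem Induces.eq_stemOf (hA : IsAlternative A) {Ω : Set A} {D : Set ℂ} {F : ℂ → Cplx A}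
    {f : A → A} (h : Induces Ω D F f) {J : A} (hJ : J ∈ imagUnits A) {z : ℂ} (hz : z ∈ D) :
    stemOf J f z = F z := by
  rw [stemOf, h.2.2 z hz J hJ, h.2.2 _ (h.2.1.2.1 z hz) J hJ, h.2.1.2.2 z hz]
  ext
  · simp only [evalAt, Cplx.re_conj, Cplx.im_conj, mul_neg]
    module
  · simp only [evalAt, Cplx.re_conj, Cplx.im_conj, mul_neg, mul_sub, mul_add,
      imagUnit_mul_mul hA hJ]
    module

theorem IsStem.im_eq_zero {D : Set ℂ} {F : ℂ → Cplx A} (h : IsStem D F) {z : ℂ} (hz : z ∈ D)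
    (h0 : z.im = 0) : (F z).im = 0 := by
  have hs : star z = z := Complex.ext (by simp) (by simp [h0])
  have h1 := congrArg Cplx.im (h.2.2 z hz)
  rw [hs, Cplx.im_conj] at h1
  have h2 : (2 : ℝ) • (F z).im = 0 := by
    rw [two_smul]
    nth_rw 1 [h1]
    exact neg_add_cancel _
  simpa using h2

theorem evalAt_neg_conj (J : A) (w : Cplx A) : evalAt (-J) w.conj = evalAt J w := by
  simp [evalAt]

theorem IsStem.evalAt_congr {D : Set ℂ} {F : ℂ → Cplx A} (h : IsStem D F) {J K : A}
    (hJ : J ∈ imagUnits A) (hK : K ∈ imagUnits A) {z w : ℂ} (hw : w ∈ D)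
    (e : toSlice J z = toSlice K w) : evalAt J (F z) = evalAt K (F w) := by
  rcases toSlice_eq_cases hJ hK e with ⟨rfl, h0 | rfl⟩ | ⟨rfl, h0 | rfl⟩
  · simp [evalAt, h.im_eq_zero hw h0]
  · rfl
  · have h1 : w.im = 0 := by simpa using h0
    rw [h.2.2 w hw]
    simp [evalAt, h.im_eq_zero hw h1]
  · rw [h.2.2 w hw, evalAt_neg_conj]

/-- Every stem function induces a slice function. -/
theorem IsStem.exists_induces {D : Set ℂ} {F : ℂ → Cplx A} (h : IsStem D F) :
    ∃ f : A → A, Induces (circularization D) D F f := by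
  classical
  refine ⟨fun x => if hx : ∃ J ∈ imagUnits A, ∃ z ∈ D, x = toSlice J z then
    evalAt hx.choose (F hx.choose_spec.2.choose) else 0, rfl, h, fun z hz J hJ => ?_⟩
  have hx : ∃ K ∈ imagUnits A, ∃ w ∈ D, toSlice J z = toSlice K w := ⟨J, hJ, z, hz, rfl⟩
  refine (dif_pos hx).trans ?_
  exact (h.evalAt_congr hJ hx.choose_spec.1 hx.choose_spec.2.choose_spec.1
    hx.choose_spec.2.choose_spec.2).symm

end Geometry

/-! ## Poles and meromorphic stem functions -/

section ScalarLaurent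

variable {g : ℂ → ℂ} {z₀ : ℂ}

/-- A function with a Laurent expansion with finite principal part is meromorphic. -/
theorem meromorphicAt_of_hasSum {c : ℤ → ℂ} {m : ℕ} (hc : ∀ k : ℕ, m < k → c (-(k : ℤ)) = 0)
    (h : ∀ᶠ z in 𝓝[≠] z₀, HasSum (fun n : ℤ => (z - z₀) ^ n * c n) (g z)) :
    MeromorphicAt g z₀ := by
  classical
  have inj : Function.Injective fun k : ℕ => (k : ℤ) - m := fun a b hab => by
    simpa using hab
  set a : ℕ → ℂ := fun k => c (k - m) with ha
  have hsum : ∀ᶠ z in 𝓝[≠] z₀, HasSum (fun k : ℕ => (z - z₀) ^ k • a k) ((z - z₀) ^ m * g z) := by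
    filter_upwards [h, self_mem_nhdsWithin] with z hz hne
    have hne' : z - z₀ ≠ 0 := sub_ne_zero.2 hne
    have h1 := hz.mul_left ((z - z₀) ^ m)
    rw [← inj.hasSum_iff] at h1
    · refine h1.congr_fun fun k => ?_
      simp only [Function.comp_apply, ha, zpow_sub₀ hne', zpow_natCast, smul_eq_mul]
      field_simp
    · intro n hn
      have : n + m < 0 := by
        by_contra! h0
        exact hn ⟨(n + m).toNat, by simp [Int.toNat_of_nonneg h0]⟩
      rw [show n = -((-n).toNat : ℤ) by omega, hc _ (by omega), mul_zero, mul_zero]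
  -- The hypothesis says nothing at `z₀` itself, so the value there is replaced by the constant term
  -- of the power series.
  set G : ℂ → ℂ := Function.update (fun z => (z - z₀) ^ m * g z) z₀ (a 0) with hG
  have hG₀ : G z₀ = a 0 := Function.update_self ..
  have hG₁ : ∀ {z}, z ≠ z₀ → G z = (z - z₀) ^ m * g z := fun hz => Function.update_of_ne hz ..
  have hGa : MeromorphicAt G z₀ := by
    refine AnalyticAt.meromorphicAt ⟨FormalMultilinearSeries.ofScalars ℂ a, ?_⟩
    rw [hasFPowerSeriesAt_iff']
    filter_upwards [eventually_nhdsWithin_iff.1 hsum] with z hz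
    simp only [FormalMultilinearSeries.coeff_ofScalars]
    by_cases e : z = z₀
    · rw [e, hG₀, sub_self]
      exact HasSum.hasSum_at_zero a
    · rw [hG₁ e]
      exact hz e
  refine (((MeromorphicAt.id z₀).sub (MeromorphicAt.const z₀ z₀)).zpow (-(m : ℤ))
    |>.mul hGa).congr ?_
  filter_upwards [self_mem_nhdsWithin] with z hne
  have hne' : z - z₀ ≠ 0 := sub_ne_zero.2 hne
  simp only [Pi.mul_apply, Pi.inv_apply, Pi.pow_apply, Pi.sub_apply, id, hG₁ hne, zpow_neg,
    zpow_natCast]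
  field_simp

/-- A meromorphic function has a Laurent expansion with finite principal part. -/
theorem exists_laurent_of_meromorphicAt (h : MeromorphicAt g z₀) :
    ∃ (c : ℤ → ℂ) (m : ℕ), (∀ k : ℕ, m < k → c (-(k : ℤ)) = 0) ∧
      ∀ᶠ z in 𝓝[≠] z₀, HasSum (fun n : ℤ => (z - z₀) ^ n * c n) (g z) := by
  obtain ⟨n, G, ⟨p, hp⟩, hg⟩ := MeromorphicAt.iff_eventuallyEq_zpow_smul_analyticAt.1 h
  rw [hasFPowerSeriesAt_iff'] at hp
  have inj : Function.Injective fun k : ℕ => (k : ℤ) + n := fun a b hab => by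
    simpa using hab
  refine ⟨fun j => if n ≤ j then p.coeff (j - n).toNat else 0, (-n).toNat,
    fun k hk => if_neg (by omega), ?_⟩
  filter_upwards [nhdsWithin_le_nhds hp, hg, self_mem_nhdsWithin] with z hz hgz hne
  have hne' : z - z₀ ≠ 0 := sub_ne_zero.2 hne
  rw [hgz, ← inj.hasSum_iff]
  · refine (hz.const_smul ((z - z₀) ^ n)).congr_fun fun k => ?_
    have e : ((k : ℤ) + n - n).toNat = k := by omega
    simp only [Function.comp_apply, if_pos (show n ≤ k + n by omega), e, zpow_add₀ hne',
      zpow_natCast, smul_eq_mul]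
    ring
  · intro j hj
    rw [if_neg, mul_zero]
    intro h0
    exact hj ⟨(j - n).toNat, by simp [Int.toNat_of_nonneg (sub_nonneg.2 h0)]⟩

/-- At a real point the Laurent coefficients can be taken real if the function is symmetric. -/
theorem exists_real_laurent_of_meromorphicAt (h : MeromorphicAt g z₀) (h0 : z₀.im = 0)
    (hs : ∀ᶠ z in 𝓝[≠] z₀, g (star z) = star (g z)) :
    ∃ (c : ℤ → ℂ) (m : ℕ), (∀ n, (c n).im = 0) ∧ (∀ k : ℕ, m < k → c (-(k : ℤ)) = 0) ∧
      ∀ᶠ z in 𝓝[≠] z₀, HasSum (fun n : ℤ => (z - z₀) ^ n * c n) (g z) := by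
  obtain ⟨c, m, hc, hsum⟩ := exists_laurent_of_meromorphicAt h
  have hz₀ : star z₀ = z₀ := Complex.ext (by simp) (by simp [h0])
  have ht : Tendsto (star : ℂ → ℂ) (𝓝[≠] z₀) (𝓝[≠] z₀) := by
    refine tendsto_nhdsWithin_iff.2 ⟨?_, ?_⟩
    · have := (continuous_star (R := ℂ)).tendsto z₀
      rw [hz₀] at this
      exact this.mono_left nhdsWithin_le_nhds
    · filter_upwards [self_mem_nhdsWithin] with z hne e
      exact hne (star_injective ((show star z = z₀ from e).trans hz₀.symm))
  refine ⟨fun n => ((c n).re : ℂ), m, fun n => Complex.ofReal_im _,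
    fun k hk => by simp [hc k hk], ?_⟩
  filter_upwards [hsum, ht.eventually hsum, hs] with z h1 h2 h3
  rw [h3] at h2
  -- Averaging the series with its reflection `star (g (star z))` replaces each coefficient by its
  -- real part.
  have h4 := (Complex.conjCLE.toContinuousLinearMap.hasSum h2).add h1
  have h5 : ∀ w : ℂ, Complex.conjCLE.toContinuousLinearMap w = star w := fun w => rfl
  have h6 : star z - z₀ = star (z - z₀) := by rw [star_sub, hz₀]
  refine (show (1 / 2 : ℂ) * (star (star (g z)) + g z) = g z by rw [star_star]; ring) ▸
    (h4.mul_left (1 / 2)).congr_fun fun n => ?_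
  rw [h5, h6, star_mul', star_zpow₀, star_star, ← mul_add]
  have h7 : star (c n) + c n = 2 * ((c n).re : ℂ) := by
    apply Complex.ext <;> simp; ring
  rw [h7]
  ring

end ScalarLaurent

/-! ### Poles of slice functions and meromorphy of their stem functions -/

section Poles

variable {A : Type*} [NormedNonAssocRing A] [NormedSpace ℝ A] [StarRing A]
  [IsScalarTower ℝ A A] [SMulCommClass ℝ A A] [StarModule ℝ A] [FiniteDimensional ℝ A]

/-- The functional `a ↦ φ(a) - i φ(J a)`, complex linear for the complex structure given by left
multiplication by `J`. -/
noncomputable def sliceFunctional (J : A) (φ : A →ₗ[ℝ] ℝ) : A →L[ℝ] ℂ :=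
  LinearMap.toContinuousLinearMap
    { toFun := fun a => ⟨φ a, -φ (J * a)⟩
      map_add' := fun a b => by apply Complex.ext <;> simp [mul_add, add_comm]
      map_smul' := fun r a => by apply Complex.ext <;> simp [mul_smul_comm] }

theorem re_sliceFunctional (J : A) (φ : A →ₗ[ℝ] ℝ) (a : A) :
    (sliceFunctional J φ a).re = φ a := rfl

theorem im_sliceFunctional (J : A) (φ : A →ₗ[ℝ] ℝ) (a : A) :
    (sliceFunctional J φ a).im = -φ (J * a) := rfl

theorem sliceFunctional_toSlice_mul (hA : IsAlternative A) {J : A} (hJ : J ∈ imagUnits A)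
    (φ : A →ₗ[ℝ] ℝ) (z : ℂ) (a : A) :
    sliceFunctional J φ (toSlice J z * a) = z * sliceFunctional J φ a := by
  apply Complex.ext <;>
    simp only [re_sliceFunctional, im_sliceFunctional, Complex.mul_re, Complex.mul_im] <;>
    simp only [toSlice, add_mul, smul_mul_assoc, one_mul, mul_add, mul_smul_comm,
      imagUnit_mul_mul hA hJ, map_add, map_smul, map_neg, smul_eq_mul] <;>
    ring

theorem coord_eq_sliceFunctional (hA : IsAlternative A) {J : A} (hJ : J ∈ imagUnits A)
    (φ : A →ₗ[ℝ] ℝ) (w : Cplx A) :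
    w.coord φ = (1 / 2 : ℂ) * (sliceFunctional J φ (evalAt J w) +
      sliceFunctional (-J) φ (evalAt (-J) w)) := by
  rw [show (1 / 2 : ℂ) = ((1 / 2 : ℝ) : ℂ) by norm_num]
  apply Complex.ext <;>
    simp only [Complex.re_ofReal_mul, Complex.im_ofReal_mul, Complex.add_re, Complex.add_im,
      re_sliceFunctional, im_sliceFunctional, Cplx.re_coord, Cplx.im_coord] <;>
    simp only [evalAt, mul_add, neg_mul, mul_neg, imagUnit_mul_mul hA hJ, map_add, map_neg] <;>
    ring

theorem eventually_star_ne (z₀ : ℂ) : ∀ᶠ z in 𝓝[≠] z₀, star z ≠ z₀ := by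
  by_cases h : star z₀ = z₀
  · filter_upwards [self_mem_nhdsWithin] with z hz e
    exact hz (star_injective ((show star z = z₀ from e).trans h.symm))
  · exact nhdsWithin_le_nhds ((continuous_star (R := ℂ)).continuousAt.eventually_ne h)

variable [Nontrivial A]

/-- On `ℂ_J` the terms are `(z - z₀)^n a_n` for the left complex structure, so the functional turns
the expansion into a scalar Laurent series. -/
theorem HasLaurentExpansion.meromorphicAt (hA : IsAlternative A) (hN : NormCompatible A) {J : A}
    (hJ : J ∈ imagUnits A) {Ω : Set A} {f : A → A} {z₀ : ℂ} {a : ℤ → A}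
    (h : HasLaurentExpansion Ω f (toSlice J z₀) a) {m : ℕ}
    (ha : ∀ k : ℕ, m < k → a (-(k : ℤ)) = 0) (φ : A →ₗ[ℝ] ℝ) :
    MeromorphicAt (fun z => sliceFunctional J φ (f (toSlice J z))) z₀ := by
  obtain ⟨R, hR, -, hsum⟩ := h
  refine meromorphicAt_of_hasSum (c := fun n => sliceFunctional J φ (a n)) (m := m)
    (fun k hk => by simp [ha k hk]) ?_
  filter_upwards [nhdsWithin_le_nhds (Metric.ball_mem_nhds z₀ hR), self_mem_nhdsWithin,
    eventually_star_ne z₀] with z hz hne hst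
  have hmem : toSlice J z ∈ sigmaAnnulus (toSlice J z₀) 0 R :=
    (toSlice_mem_sigmaAnnulus hN hJ).2 ⟨norm_pos_iff.2 (sub_ne_zero.2 hne),
      mem_ball_iff_norm.1 hz⟩
  refine ((sliceFunctional J φ).hasSum (hsum z J hJ hmem)).congr_fun fun n => ?_
  rw [evalAt_laurentTerm hA hJ hne hst, sliceFunctional_toSlice_mul hA hJ]

/-- The extension is defined on a circular set, hence on the whole sphere of the point. Its stem
function is holomorphic at `z₀` and agrees with `F` nearby. -/
theorem IsRemovable.isMeroAt (hA : IsAlternative A) {J : A} (hJ : J ∈ imagUnits A) {Ω : Set A}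
    {D : Set ℂ} {F : ℂ → Cplx A} {f : A → A} (hf : Induces Ω D F f) {z₀ : ℂ}
    (hD : ∀ᶠ z in 𝓝[≠] z₀, z ∈ D) (h : IsRemovable Ω f (toSlice J z₀)) : IsMeroAt F z₀ := by
  obtain ⟨-, V, g, -, hV, hy, ⟨hVo, D', G, hg, hc, hdb⟩, hfg⟩ := h
  have hD' := hg.2.1.2.1
  have hopen : IsOpen D' := by
    rw [← shadow_circularization ⟨J, hJ⟩ hD', ← hg.1]
    exact hVo.isOpen_shadow
  have hz₀ : z₀ ∈ D' := by
    rw [hg.1] at hy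
    exact toSlice_mem_iff hJ hD' _ hy
  refine (hc.isHolAt hopen hdb hz₀).isMeroAt.congr ?_
  filter_upwards [hD, nhdsWithin_le_nhds (hopen.mem_nhds hz₀)] with z hz hz'
  rw [← hf.eq_stemOf hA hJ hz, ← hg.eq_stemOf hA hJ hz']
  have hmem : ∀ w ∈ D, g (toSlice J w) = f (toSlice J w) := fun w hw =>
    hfg (by rw [hf.1]; exact toSlice_mem_circularization_of_mem hJ hw)
  rw [stemOf, stemOf, hmem z hz, hmem _ (hf.2.1.2.1 z hz)]

/-- A pole at one point controls only one of `F₁ + J F₂` and `F₁ - J F₂`; both are needed to recover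
`F`. If one of the two points is removable, that point suffices. -/
theorem isMeroAt_of_isPole_or_isRemovable (hA : IsAlternative A) (hN : NormCompatible A) {J : A}
    (hJ : J ∈ imagUnits A) {Ω : Set A} {D : Set ℂ} {F : ℂ → Cplx A} {f : A → A}
    (hf : Induces Ω D F f) {z₀ : ℂ} (hD : ∀ᶠ z in 𝓝[≠] z₀, z ∈ D)
    (h1 : IsPole Ω f (toSlice J z₀) ∨ IsRemovable Ω f (toSlice J z₀))
    (h2 : IsPole Ω f (toSlice (-J) z₀) ∨ IsRemovable Ω f (toSlice (-J) z₀)) : IsMeroAt F z₀ := by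
  have hJ' := neg_mem_imagUnits hJ
  rcases h1 with ⟨-, a, ha, m, hm⟩ | h1
  · rcases h2 with ⟨-, a', ha', m', hm'⟩ | h2
    · intro φ
      refine ((MeromorphicAt.const (1 / 2 : ℂ) z₀).mul
        ((ha.meromorphicAt hA hN hJ hm φ).add (ha'.meromorphicAt hA hN hJ' hm' φ))).congr ?_
      filter_upwards [hD] with z hz
      rw [coord_eq_sliceFunctional hA hJ, ← hf.2.2 z hz J hJ, ← hf.2.2 z hz _ hJ']
      rfl
    · exact h2.isMeroAt hA hJ' hf hD
  · exact h1.isMeroAt hA hJ hf hD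

theorem evalAt_eq_sum {ι : Type*} [Fintype ι] (b : Module.Basis ι ℝ A) (J : A) (w : Cplx A) :
    evalAt J w = ∑ i, toSlice J (w.coord (b.coord i)) * b i := by
  simp only [evalAt, toSlice, Cplx.re_coord, Cplx.im_coord, add_mul, smul_mul_assoc, one_mul,
    Finset.sum_add_distrib, Module.Basis.coord_apply]
  rw [b.sum_repr]
  congr 1
  conv_lhs => rw [← b.sum_repr w.im, Finset.mul_sum]
  simp only [mul_smul_comm]

/-- `evalAt J` replaces `i` by `J` in the coordinates; the common factor `ζ ^ n` can then be pulled
out on the left by `toSlice_mul_mul`. -/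
theorem hasSum_evalAt (hA : IsAlternative A) {ι : Type*} [Fintype ι] (b : Module.Basis ι ℝ A)
    {J : A} (hJ : J ∈ imagUnits A) {w : Cplx A} {ζ : ℂ} {c : ι → ℤ → ℂ}
    (h : ∀ i, HasSum (fun n : ℤ => ζ ^ n * c i n) (w.coord (b.coord i))) :
    HasSum (fun n : ℤ => toSlice J (ζ ^ n) * ∑ i, toSlice J (c i n) * b i) (evalAt J w) := by
  rw [evalAt_eq_sum b]
  let L : ι → ℂ →ₗ[ℝ] A := fun i =>
    { toFun := fun z => toSlice J z * b i
      map_add' := fun z w => by rw [toSlice_add, add_mul]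
      map_smul' := fun r z => by
        simp only [toSlice, Complex.smul_re, Complex.smul_im, smul_eq_mul, mul_smul, ← smul_add,
          smul_mul_assoc, RingHom.id_apply] }
  refine (hasSum_sum fun i _ => (LinearMap.toContinuousLinearMap (L i)).hasSum (h i)).congr_fun
    fun n => ?_
  rw [Finset.mul_sum]
  exact Finset.sum_congr rfl fun i _ => toSlice_mul_mul hA hJ _ _ _

theorem isPole_of_isMeroAt (hA : IsAlternative A) (hN : NormCompatible A) {J : A}
    (hJ : J ∈ imagUnits A) {Ω : Set A} {D : Set ℂ} {F : ℂ → Cplx A} {f : A → A}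
    (hf : Induces Ω D F f) {z₀ : ℂ} (hD : ∀ᶠ z in 𝓝[≠] z₀, z ∈ D) (hm : IsMeroAt F z₀) :
    IsPole Ω f (toSlice J z₀) := by
  obtain ⟨rfl, hst, hval⟩ := hf
  let b := Module.finBasis ℝ A
  -- An annulus around a real point meets every plane `ℂ_K`, and the coefficients `a_n` must not
  -- depend on `K`; hence real `c n` there.
  have hex : ∀ i, ∃ (c : ℤ → ℂ) (m : ℕ), (z₀.im = 0 → ∀ n, (c n).im = 0) ∧
      (∀ k : ℕ, m < k → c (-(k : ℤ)) = 0) ∧ ∀ᶠ z in 𝓝[≠] z₀,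
        HasSum (fun n : ℤ => (z - z₀) ^ n * c n) ((F z).coord (b.coord i)) := by
    intro i
    by_cases h0 : z₀.im = 0
    · obtain ⟨c, m, h1, h2, h3⟩ := exists_real_laurent_of_meromorphicAt (hm (b.coord i)) h0 (by
        filter_upwards [hD] with z hz
        rw [hst.2.2 z hz]
        apply Complex.ext <;> simp)
      exact ⟨c, m, fun _ => h1, h2, h3⟩
    · obtain ⟨c, m, h2, h3⟩ := exists_laurent_of_meromorphicAt (hm (b.coord i))
      exact ⟨c, m, fun h => absurd h h0, h2, h3⟩
  choose c m hreal hzero hsum using hex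
  obtain ⟨R₀, hR₀, hball⟩ := Metric.eventually_nhds_iff.1
    (eventually_nhdsWithin_iff.1 (hD.and (eventually_all.2 hsum)))
  -- For non-real `z₀`, the bound `R ≤ |z₀.im|` keeps the annulus inside `ℂ_J` and away from `star
  -- z₀`.
  obtain ⟨R, hR, hle, him⟩ : ∃ R > 0, R ≤ R₀ ∧ (z₀.im ≠ 0 → R ≤ |z₀.im|) := by
    by_cases h0 : z₀.im = 0
    · exact ⟨R₀, hR₀, le_rfl, fun h => absurd h0 h⟩
    · exact ⟨min R₀ |z₀.im|, lt_min hR₀ (abs_pos.2 h0), min_le_left _ _, fun _ => min_le_right _ _⟩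
  have hgood : ∀ z, 0 < ‖z - z₀‖ → ‖z - z₀‖ < R → z ∈ D ∧ ∀ i,
      HasSum (fun n : ℤ => (z - z₀) ^ n * c i n) ((F z).coord (b.coord i)) := fun z h1 h2 =>
    hball (by rw [dist_eq_norm]; exact h2.trans_le hle) (sub_ne_zero.1 (norm_pos_iff.1 h1))
  have hstar : ∀ z, 0 < ‖z - z₀‖ → ‖z - z₀‖ < R → star z ≠ z₀ := by
    intro z h1 h2 e
    have e' : z = star z₀ := by rw [← e, star_star]
    by_cases h0 : z₀.im = 0
    · refine norm_pos_iff.1 h1 (sub_eq_zero.2 (e'.trans ?_))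
      exact Complex.ext (by simp) (by simp [h0])
    · have h3 := Complex.abs_im_le_norm (z - z₀)
      have h4 : (z - z₀).im = -(2 * z₀.im) := by rw [e']; simp; ring
      rw [h4, abs_neg, abs_mul, abs_two] at h3
      linarith [him h0, abs_pos.2 h0]
  have hcases : ∀ z, ∀ K ∈ imagUnits A, toSlice K z ∈ sigmaAnnulus (toSlice J z₀) 0 R →
      ((z₀.im = 0 ∨ K = J) ∧ 0 < ‖z - z₀‖ ∧ ‖z - z₀‖ < R) ∨
        (K = -J ∧ 0 < ‖star z - z₀‖ ∧ ‖star z - z₀‖ < R) := by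
    intro z K hK hz
    by_cases h0 : z₀.im = 0
    · have e : toSlice J z₀ = toSlice K z₀ := by simp [toSlice, h0]
      rw [e, toSlice_mem_sigmaAnnulus hN hK] at hz
      exact Or.inl ⟨Or.inl h0, hz⟩
    · exact (mem_sigmaAnnulus_cases hN hJ hK h0 (him h0) hz).imp_left fun h => ⟨Or.inr h.1, h.2⟩
  have hsub : sigmaAnnulus (toSlice J z₀) 0 R ⊆ circularization D := by
    intro x hx
    obtain ⟨K, hK, z, rfl⟩ := exists_toSlice_eq ⟨J, hJ⟩ hx.1
    rw [toSlice_mem_circularization hK hst.2.1]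
    rcases hcases z K hK hx with ⟨-, h1, h2⟩ | ⟨-, h1, h2⟩
    · exact (hgood z h1 h2).1
    · simpa using hst.2.1 _ (hgood _ h1 h2).1
  refine ⟨⟨toSlice_mem_cone hJ z₀, R, hR, hsub⟩, fun n => ∑ i, toSlice J (c i n) * b i,
    ⟨R, hR, hsub, fun z K hK hz => ?_⟩, Finset.univ.sup m, fun k hk => ?_⟩
  · rcases hcases z K hK hz with ⟨h0, h1, h2⟩ | ⟨rfl, h1, h2⟩
    · have e : toSlice J z₀ = toSlice K z₀ := by
        rcases h0 with h0 | rfl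
        · simp [toSlice, h0]
        · rfl
      have e' : ∀ n, ∑ i, toSlice J (c i n) * b i = ∑ i, toSlice K (c i n) * b i := by
        rcases h0 with h0 | rfl
        · intro n; simp [toSlice, hreal _ h0]
        · exact fun _ => rfl
      rw [hval z (hgood z h1 h2).1 K hK]
      refine (hasSum_evalAt hA b hK (hgood z h1 h2).2).congr_fun fun n => ?_
      rw [e, evalAt_laurentTerm hA hK (sub_ne_zero.1 (norm_pos_iff.1 h1)) (hstar z h1 h2)]
      exact congrArg _ (e' n)
    · have hw := hgood _ h1 h2
      -- The point `toSlice (-J) z` is `toSlice J (star z)`, so the series is the one already summed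
      -- at `star z`.
      rw [toSlice_neg, hval _ hw.1 J hJ]
      refine (hasSum_evalAt hA b hJ hw.2).congr_fun fun n => ?_
      have hs := hstar _ h1 h2
      rw [star_star] at hs
      rw [evalAt_neg_laurentTerm hA hJ hs (sub_ne_zero.1 (norm_pos_iff.1 h1))]
  · exact Finset.sum_eq_zero fun i _ => by
      rw [hzero i k ((Finset.le_sup (Finset.mem_univ i)).trans_lt hk), toSlice_zero, zero_mul]

end Poles

/-! ## Transport of a *-algebra structure along an injection with closed range -/

/-- A subset of a real nonassociative *-algebra, given as the range of an injection and closed under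
the operations, is a real nonassociative *-algebra. -/
theorem exists_starAlgebra_of_injective {S B : Type*} [NonAssocRing B] [Module ℝ B] [StarRing B]
    (ι : S → B) (hι : Function.Injective ι) (hone : ∃ s, ι s = 1)
    (hadd : ∀ s t, ∃ u, ι u = ι s + ι t) (hmul : ∀ s t, ∃ u, ι u = ι s * ι t)
    (hstar : ∀ s, ∃ u, ι u = star (ι s)) (hsmul : ∀ (r : ℝ) s, ∃ u, ι u = r • ι s) :
    ∃ (_ : NonAssocRing S) (_ : Module ℝ S) (_ : StarRing S), ι 1 = 1 ∧
      (∀ s t, ι (s + t) = ι s + ι t) ∧ (∀ s t, ι (s * t) = ι s * ι t) ∧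
      (∀ s, ι (star s) = star (ι s)) ∧ ∀ (r : ℝ) s, ι (r • s) = r • ι s := by
  choose add add_spec using hadd
  choose mul mul_spec using hmul
  choose st st_spec using hstar
  choose sm sm_spec using hsmul
  obtain ⟨o, ho⟩ := hone
  let : One S := ⟨o⟩
  -- Zero, negation, integer multiples and casts all come from real scalars, so no further closure
  -- hypotheses are needed.
  let : Zero S := ⟨sm 0 o⟩
  let : Add S := ⟨add⟩
  let : Mul S := ⟨mul⟩
  let : Star S := ⟨st⟩
  let : SMul ℝ S := ⟨sm⟩
  let : Neg S := ⟨sm (-1)⟩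
  let : Sub S := ⟨fun s t => s + -t⟩
  let : SMul ℕ S := ⟨fun n => sm n⟩
  let : SMul ℤ S := ⟨fun n => sm n⟩
  let : NatCast S := ⟨fun n => sm n o⟩
  let : IntCast S := ⟨fun n => sm n o⟩
  have h0 : ι 0 = 0 := (sm_spec 0 o).trans (zero_smul ℝ _)
  have hneg : ∀ s, ι (-s) = -ι s := fun s => (sm_spec (-1) s).trans (by rw [neg_smul, one_smul])
  have hcast : ∀ n : ℕ, ι n = n := fun n => (sm_spec n o).trans (by
    rw [ho, Nat.cast_smul_eq_nsmul, nsmul_one])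
  have hcast' : ∀ n : ℤ, ι n = n := fun n => (sm_spec n o).trans (by
    rw [ho, Int.cast_smul_eq_zsmul, zsmul_one])
  let R : NonAssocRing S := hι.nonAssocRing ι h0 ho add_spec mul_spec hneg
    (fun s t => (add_spec s (-t)).trans (by rw [hneg, sub_eq_add_neg]))
    (fun n s => (sm_spec n s).trans (Nat.cast_smul_eq_nsmul ℝ n _))
    (fun n s => (sm_spec n s).trans (Int.cast_smul_eq_zsmul ℝ n _)) hcast hcast'
  let ια : S →+ B := { toFun := ι, map_zero' := h0, map_add' := add_spec }
  let M : Module ℝ S := hι.module ℝ ια sm_spec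
  let T : StarRing S :=
    { star := st
      star_involutive := fun s => hι (by
        rw [st_spec, st_spec, star_star])
      star_mul := fun s t => hι (by
        change ι (st (mul s t)) = ι (mul (st t) (st s))
        rw [st_spec, mul_spec, mul_spec, st_spec, st_spec, star_mul])
      star_add := fun s t => hι (by
        change ι (st (add s t)) = ι (add (st s) (st t))
        rw [st_spec, add_spec, add_spec, st_spec, st_spec, star_add]) }
  exact ⟨R, M, T, ho, add_spec, mul_spec, st_spec, sm_spec⟩

/-! ### Semiregular functions as germs of meromorphic stem functions -/

section Germs

variable {A : Type*} [NormedNonAssocRing A] [NormedSpace ℝ A] [StarRing A]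

instance germStarRing {α : Type*} (l : Filter α) {B : Type*} [NonAssocRing B] [StarRing B] :
    StarRing (Germ l B) where
  star := Germ.map star
  star_involutive x := Germ.inductionOn x fun f => by
    change ((star ∘ star ∘ f : α → B) : Germ l B) = f
    congr 1
    funext a
    exact star_star _
  star_mul x y := Germ.inductionOn₂ x y fun f g => by
    change ((star ∘ (f * g) : α → B) : Germ l B) = ((star ∘ g * star ∘ f : α → B) : Germ l B)
    congr 1
    funext a
    exact star_mul _ _
  star_add x y := Germ.inductionOn₂ x y fun f g => by
    change ((star ∘ (f + g) : α → B) : Germ l B) = ((star ∘ f + star ∘ g : α → B) : Germ l B)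
    congr 1
    funext a
    exact star_add _ _

/-- The filter of punctured neighborhoods of all points of the shadow of `Ω`. -/
noncomputable def puncturedNhds (Ω : Set A) : Filter ℂ := ⨆ z ∈ shadow Ω, 𝓝[≠] z

theorem eventually_puncturedNhds {Ω : Set A} {p : ℂ → Prop} :
    (∀ᶠ w in puncturedNhds Ω, p w) ↔ ∀ z ∈ shadow Ω, ∀ᶠ w in 𝓝[≠] z, p w := by
  simp only [puncturedNhds, eventually_iSup]

variable [IsScalarTower ℝ A A] [SMulCommClass ℝ A A] [StarModule ℝ A] [FiniteDimensional ℝ A]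
  [Nontrivial A]

/-- `F` is a stem function, holomorphic on the open set `D` and meromorphic on the shadow of `Ω`,
the complement of `D` being discrete. -/
structure IsMeroStem (Ω : Set A) (D : Set ℂ) (F : ℂ → Cplx A) : Prop where
  isOpen : IsOpen D
  subset : D ⊆ shadow Ω
  isStem : IsStem D F
  isHolAt : ∀ z ∈ D, IsHolAt F z
  punctured : ∀ z ∈ shadow Ω, ∀ᶠ w in 𝓝[≠] z, w ∈ D
  isMeroAt : ∀ z ∈ shadow Ω, IsMeroAt F z

section MeroStem

variable {Ω : Set A} {D D' : Set ℂ} {F G : ℂ → Cplx A}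

theorem IsMeroStem.eventually (h : IsMeroStem Ω D F) : ∀ᶠ w in puncturedNhds Ω, w ∈ D :=
  eventually_puncturedNhds.2 h.punctured

theorem IsMeroStem.inter_nonempty (hF : IsMeroStem Ω D F) (hG : IsMeroStem Ω D' G) :
    (D ∩ D').Nonempty := by
  obtain ⟨z, hz⟩ := hF.isStem.1
  exact ((hF.punctured z (hF.subset hz)).and (hG.punctured z (hF.subset hz))).exists

theorem IsMeroStem.add (hF : IsMeroStem Ω D F) (hG : IsMeroStem Ω D' G) :
    IsMeroStem Ω (D ∩ D') (fun z => F z + G z) where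
  isOpen := hF.isOpen.inter hG.isOpen
  subset := inter_subset_left.trans hF.subset
  isStem := ⟨hF.inter_nonempty hG, fun z hz => ⟨hF.isStem.2.1 z hz.1, hG.isStem.2.1 z hz.2⟩,
    fun z hz => by dsimp only; rw [hF.isStem.2.2 z hz.1, hG.isStem.2.2 z hz.2, Cplx.conj_add]⟩
  isHolAt z hz := (hF.isHolAt z hz.1).add (hG.isHolAt z hz.2)
  punctured z hz := (hF.punctured z hz).and (hG.punctured z hz)
  isMeroAt z hz := (hF.isMeroAt z hz).add (hG.isMeroAt z hz)

theorem IsMeroStem.mul (hF : IsMeroStem Ω D F) (hG : IsMeroStem Ω D' G) :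
    IsMeroStem Ω (D ∩ D') (fun z => F z * G z) where
  isOpen := hF.isOpen.inter hG.isOpen
  subset := inter_subset_left.trans hF.subset
  isStem := ⟨hF.inter_nonempty hG, fun z hz => ⟨hF.isStem.2.1 z hz.1, hG.isStem.2.1 z hz.2⟩,
    fun z hz => by dsimp only; rw [hF.isStem.2.2 z hz.1, hG.isStem.2.2 z hz.2, Cplx.conj_mul]⟩
  isHolAt z hz := (hF.isHolAt z hz.1).mul (hG.isHolAt z hz.2)
  punctured z hz := (hF.punctured z hz).and (hG.punctured z hz)
  isMeroAt z hz := (hF.isMeroAt z hz).mul (hG.isMeroAt z hz)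

theorem IsMeroStem.star (hF : IsMeroStem Ω D F) : IsMeroStem Ω D (fun z => star (F z)) where
  isOpen := hF.isOpen
  subset := hF.subset
  isStem := ⟨hF.isStem.1, hF.isStem.2.1,
    fun z hz => by dsimp only; rw [hF.isStem.2.2 z hz, Cplx.conj_star]⟩
  isHolAt z hz := (hF.isHolAt z hz).star
  punctured := hF.punctured
  isMeroAt z hz := (hF.isMeroAt z hz).star

theorem IsMeroStem.smul (r : ℝ) (hF : IsMeroStem Ω D F) : IsMeroStem Ω D (fun z => r • F z) where
  isOpen := hF.isOpen
  subset := hF.subset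
  isStem := ⟨hF.isStem.1, hF.isStem.2.1,
    fun z hz => by dsimp only; rw [hF.isStem.2.2 z hz, Cplx.conj_smul]⟩
  isHolAt z hz := (hF.isHolAt z hz).smul r
  punctured := hF.punctured
  isMeroAt z hz := (hF.isMeroAt z hz).smul r

/-- A holomorphic stem function on the whole shadow of an open set. -/
theorem isMeroStem_of_isHolAt (ho : IsOpen (shadow Ω)) (hs : IsStem (shadow Ω) F)
    (hF : ∀ z ∈ shadow Ω, IsHolAt F z) : IsMeroStem Ω (shadow Ω) F where
  isOpen := ho
  subset := subset_rfl
  isStem := hs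
  isHolAt := hF
  punctured _ hz := nhdsWithin_le_nhds (ho.mem_nhds hz)
  isMeroAt z hz := (hF z hz).isMeroAt

theorem isMeroStem_const (ho : IsOpen (shadow Ω)) (hne : (shadow Ω).Nonempty) (a : A) :
    IsMeroStem Ω (shadow Ω) (fun _ => Cplx.ofAlg a) :=
  isMeroStem_of_isHolAt ho ⟨hne, conjInvariant_shadow Ω, fun _ _ => by ext <;> simp⟩
    fun _ _ => isHolAt_const _ _

end MeroStem

theorem Induces.congr {Ω : Set A} {D : Set ℂ} {F G : ℂ → Cplx A} {f : A → A}
    (h : Induces Ω D F f) (e : ∀ z ∈ D, G z = F z) : Induces Ω D G f :=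
  ⟨h.1, ⟨h.2.1.1, h.2.1.2.1, fun z hz => by
    rw [e z hz, e _ (h.2.1.2.1 z hz), h.2.1.2.2 z hz]⟩, fun z hz J hJ => by
    rw [e z hz, h.2.2 z hz J hJ]⟩

theorem Induces.restrict {Ω : Set A} {D D' : Set ℂ} {F : ℂ → Cplx A} {f : A → A}
    (h : Induces Ω D F f) (hs : D' ⊆ D) (hc : ConjInvariant D') (hne : D'.Nonempty) :
    Induces (circularization D') D' F f :=
  ⟨rfl, ⟨hne, hc, fun z hz => h.2.1.2.2 z (hs hz)⟩, fun z hz => h.2.2 z (hs hz)⟩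

theorem SemiregularRep.induces (hA : IsAlternative A) {J : A} (hJ : J ∈ imagUnits A) {Ω : Set A}
    (f : SemiregularRep Ω) : Induces f.dom (shadow f.dom) (stemOf J f.toFun) f.toFun := by
  obtain ⟨-, D, F, hF, -, -⟩ := f.regular
  have hD : shadow f.dom = D := by rw [hF.1, shadow_circularization ⟨J, hJ⟩ hF.2.1.2.1]
  rw [hD]
  exact hF.congr fun z hz => hF.eq_stemOf hA hJ hz

/-- Around each point of the shadow the domain contains a punctured neighborhood, by openness or
because the point is a singularity. Circularity of `Ω` supplies a pole or removable point at both
`±J`. -/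
theorem SemiregularRep.isMeroStem (hA : IsAlternative A) (hN : NormCompatible A) {J : A}
    (hJ : J ∈ imagUnits A) {Ω : Set A} (hΩ : IsCircular Ω) (f : SemiregularRep Ω) :
    IsMeroStem Ω (shadow f.dom) (stemOf J f.toFun) := by
  have hi := f.induces hA hJ
  have ho : IsOpen (shadow f.dom) := f.regular.1.isOpen_shadow
  have hhol : ∀ z ∈ shadow f.dom, IsHolAt (stemOf J f.toFun) z := by
    obtain ⟨-, D, F, hF, hc, hd⟩ := f.regular
    have hD : shadow f.dom = D := by rw [hF.1, shadow_circularization ⟨J, hJ⟩ hF.2.1.2.1]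
    rw [hD] at ho ⊢
    intro z hz
    refine (hc.isHolAt ho hd hz).congr ?_
    filter_upwards [ho.mem_nhds hz] with w hw using (hF.eq_stemOf hA hJ hw).symm
  have hsing : ∀ z ∈ shadow Ω, z ∉ shadow f.dom → ∀ K ∈ imagUnits A,
      IsPole f.dom f.toFun (toSlice K z) ∨ IsRemovable f.dom f.toFun (toSlice K z) :=
    fun z hz hz' K hK =>
      f.sing _ ⟨(hΩ.toSlice_mem hK).2 hz, fun h => hz' ((f.circular.toSlice_mem hK).1 h)⟩
  have hp : ∀ z ∈ shadow Ω, ∀ᶠ w in 𝓝[≠] z, w ∈ shadow f.dom := by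
    intro z hz
    by_cases h : z ∈ shadow f.dom
    · exact nhdsWithin_le_nhds (ho.mem_nhds h)
    · have hs : IsSingularity f.dom (toSlice J z) := (hsing z hz h J hJ).elim And.left And.left
      filter_upwards [hs.eventually hJ] with w hw using ⟨J, hJ, hw⟩
  refine ⟨ho, fun z ⟨K, hK, hz⟩ => ⟨K, hK, f.dom_subset hz⟩, hi.2.1, hhol, hp, fun z hz => ?_⟩
  by_cases h : z ∈ shadow f.dom
  · exact (hhol z h).isMeroAt
  · exact isMeroAt_of_isPole_or_isRemovable hA hN hJ hi (hp z hz) (hsing z hz h J hJ)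
      (hsing z hz h _ (neg_mem_imagUnits hJ))

/-- The germ of the stem function of a semiregular function. -/
noncomputable def stemGerm (J : A) {Ω : Set A} (x : Semiregular Ω) :
    Germ (puncturedNhds Ω) (Cplx A) :=
  (stemOf J (Quotient.out x).toFun : ℂ → Cplx A)

/-- Independence of the chosen representative: two equivalent ones agree on their common domain,
whose shadow belongs to the filter `puncturedNhds Ω`. -/
theorem stemGerm_toSemiregular (hA : IsAlternative A) (hN : NormCompatible A) {J : A}
    (hJ : J ∈ imagUnits A) {Ω : Set A} (hΩ : IsCircular Ω) (f : SemiregularRep Ω) :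
    stemGerm J f.toSemiregular = (stemOf J f.toFun : ℂ → Cplx A) := by
  have h : EqOn (Quotient.out f.toSemiregular).toFun f.toFun
      ((Quotient.out f.toSemiregular).dom ∩ f.dom) := Quotient.mk_out (s := semiregularSetoid Ω) f
  unfold stemGerm
  generalize Quotient.out f.toSemiregular = g at h ⊢
  rw [Germ.coe_eq]
  filter_upwards [(f.isMeroStem hA hN hJ hΩ).eventually, (g.isMeroStem hA hN hJ hΩ).eventually]
    with z hf hg
  have key : ∀ w, w ∈ shadow f.dom → w ∈ shadow g.dom →
      g.toFun (toSlice J w) = f.toFun (toSlice J w) := fun w h1 h2 =>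
    h ⟨(g.circular.toSlice_mem hJ).2 h2, (f.circular.toSlice_mem hJ).2 h1⟩
  rw [stemOf, stemOf, key z hf hg,
    key _ (conjInvariant_shadow _ _ hf) (conjInvariant_shadow _ _ hg)]

/-- Near a point of the common domain the stem functions agree off that point, hence also at it by
continuity. -/
theorem stemGerm_injective (hA : IsAlternative A) (hN : NormCompatible A) {J : A}
    (hJ : J ∈ imagUnits A) {Ω : Set A} (hΩ : IsCircular Ω) :
    Function.Injective (stemGerm J : Semiregular Ω → Germ (puncturedNhds Ω) (Cplx A)) := by
  intro x y
  refine Quotient.inductionOn₂ x y fun f g e => Quotient.sound ?_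
  change stemGerm J f.toSemiregular = stemGerm J g.toSemiregular at e
  rw [stemGerm_toSemiregular hA hN hJ hΩ, stemGerm_toSemiregular hA hN hJ hΩ, Germ.coe_eq,
    EventuallyEq, eventually_puncturedNhds] at e
  intro x hx
  have hf := f.isMeroStem hA hN hJ hΩ
  have hg := g.isMeroStem hA hN hJ hΩ
  obtain ⟨K, hK, z, rfl⟩ := exists_toSlice_eq ⟨J, hJ⟩ (show x ∈ quadraticCone A by
    have := hx.1
    rw [← f.circular.circularization_shadow] at this
    exact this.1)
  have hz := (f.circular.toSlice_mem hK).1 hx.1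
  have hz' := (g.circular.toSlice_mem hK).1 hx.2
  rw [(f.induces hA hJ).2.2 z hz K hK, (g.induces hA hJ).2.2 z hz' K hK]
  congr 1
  refine Cplx.eq_of_coord fun φ => ?_
  refine tendsto_nhds_unique_of_eventuallyEq
    ((hf.isHolAt z hz φ).continuousAt.tendsto.mono_left (nhdsWithin_le_nhds (s := {z}ᶜ)))
    ((hg.isHolAt z hz' φ).continuousAt.tendsto.mono_left (nhdsWithin_le_nhds (s := {z}ᶜ))) ?_
  filter_upwards [e z (hf.subset hz)] with w hw
  rw [hw]

/-- A meromorphic stem function induces a semiregular function. -/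
theorem IsMeroStem.exists_rep (hA : IsAlternative A) (hN : NormCompatible A) {J : A}
    (hJ : J ∈ imagUnits A) {Ω : Set A} (hΩ : IsCircular Ω) {D : Set ℂ} {F : ℂ → Cplx A}
    (h : IsMeroStem Ω D F) : ∃ f : SemiregularRep Ω, f.dom = circularization D ∧
      Induces f.dom D F f.toFun ∧ stemGerm J f.toSemiregular = (F : ℂ → Cplx A) := by
  obtain ⟨f, hf⟩ := h.isStem.exists_induces
  have hc := h.isStem.2.1
  let r : SemiregularRep Ω :=
    { dom := circularization D
      toFun := f
      dom_subset := by
        rintro x ⟨-, z, hz, K, hK, rfl⟩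
        exact (hΩ.toSlice_mem hK).2 (h.subset hz)
      circular := ⟨D, rfl⟩
      regular := ⟨isOpenInCone_circularization ⟨J, hJ⟩ hN h.isOpen hc, D, F, hf,
        isC1_of_isHolAt h.isHolAt, fun z hz => dbar_eq_zero_of_isHolAt h.isOpen h.isHolAt hz⟩
      sing := by
        rintro y ⟨hy, -⟩
        rw [← hΩ.circularization_shadow] at hy
        obtain ⟨-, z, hz, K, hK, rfl⟩ := hy
        -- `IsPole` only requires a finite principal part, possibly zero, so removable points need
        -- no separate treatment.
        exact Or.inl (isPole_of_isMeroAt hA hN hK hf (h.punctured z hz) (h.isMeroAt z hz)) }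
  refine ⟨r, rfl, hf, ?_⟩
  rw [stemGerm_toSemiregular hA hN hJ hΩ, Germ.coe_eq]
  filter_upwards [h.eventually] with z hz using hf.eq_stemOf hA hJ hz

end Germs

/-! ### Algebraic laws for germs with values in `A_ℂ` -/

section GermAlgebra

variable {A : Type*} [NonAssocRing A] [Module ℝ A] {l : Filter ℂ}

theorem germ_smul_mul [IsScalarTower ℝ A A] (r : ℝ) (x y : Germ l (Cplx A)) :
    r • x * y = r • (x * y) := Germ.inductionOn₂ x y fun f g => by
  change ((r • f * g : ℂ → Cplx A) : Germ l (Cplx A)) = (r • (f * g) : ℂ → Cplx A)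
  congr 1
  funext z
  ext <;> simp [smul_mul_assoc, smul_sub, smul_add]

theorem germ_mul_smul [SMulCommClass ℝ A A] (r : ℝ) (x y : Germ l (Cplx A)) :
    x * r • y = r • (x * y) := Germ.inductionOn₂ x y fun f g => by
  change ((f * r • g : ℂ → Cplx A) : Germ l (Cplx A)) = (r • (f * g) : ℂ → Cplx A)
  congr 1
  funext z
  ext <;> simp [mul_smul_comm, smul_sub, smul_add]

theorem germ_star_smul [StarRing A] [StarModule ℝ A] (r : ℝ) (x : Germ l (Cplx A)) :
    star (r • x) = r • star x := Germ.inductionOn x fun f => by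
  change ((fun z => star (r • f z) : ℂ → Cplx A) : Germ l (Cplx A)) =
    (fun z => r • star (f z) : ℂ → Cplx A)
  congr 1
  funext z
  ext <;> simp

theorem germ_isAlternative (hA : IsAlternative A) : IsAlternative (Germ l (Cplx A)) := by
  intro x y
  refine Germ.inductionOn₂ x y fun f g => ⟨?_, ?_⟩
  · change ((fun z => associator (f z) (f z) (g z) : ℂ → Cplx A) : Germ l (Cplx A)) =
      (fun _ => 0 : ℂ → Cplx A)
    simp only [(Cplx.isAlternative hA _ _).1]
  · change ((fun z => associator (g z) (f z) (f z) : ℂ → Cplx A) : Germ l (Cplx A)) =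
      (fun _ => 0 : ℂ → Cplx A)
    simp only [(Cplx.isAlternative hA _ _).2]

end GermAlgebra

/-! ## Nonsingularity -/

section Nonsingular

variable {A : Type*} [NormedNonAssocRing A] [NormedSpace ℝ A] [StarRing A]
  [IsScalarTower ℝ A A] [SMulCommClass ℝ A A] [StarModule ℝ A] [FiniteDimensional ℝ A]
  [Nontrivial A]

/-- The identity principle for meromorphic functions with values in the complexification. -/
theorem eventually_eq_zero_of_frequently {F : ℂ → Cplx A} {D : Set ℂ} (hD : IsPreconnected D)
    (hF : ∀ z ∈ D, IsMeroAt F z) {u : ℂ} (hu : u ∈ D) (h : ∃ᶠ w in 𝓝[≠] u, F w = 0) {z : ℂ}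
    (hz : z ∈ D) : ∀ᶠ w in 𝓝[≠] z, F w = 0 := by
  let b := Module.finBasis ℝ A
  have key : ∀ i, ∀ᶠ w in 𝓝[≠] z, (F w).coord (b.coord i) = 0 := by
    intro i
    have hm : MeromorphicOn (fun w => (F w).coord (b.coord i)) D := fun w hw => hF w hw _
    rw [← meromorphicOrderAt_eq_top_iff]
    by_contra hne
    -- On a preconnected set the order is infinite everywhere or nowhere; zeros accumulating at `u`
    -- make it infinite at `u`.
    refine hm.meromorphicOrderAt_ne_top_of_isPreconnected hD hz hu hne ?_
    rw [meromorphicOrderAt_eq_top_iff]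
    refine (hm u hu).frequently_zero_iff_eventuallyEq_zero.1 (h.mono fun w hw => ?_)
    rw [hw, Cplx.coord_zero]
  filter_upwards [eventually_all.2 key] with w hw
  ext
  · exact b.ext_elem fun i => by simpa using congrArg Complex.re (hw i)
  · exact b.ext_elem fun i => by simpa using congrArg Complex.im (hw i)

theorem eventually_eq_zero_of_mul_star (hA : IsNonsingular A)
    {Ω : Set A} (hU : IsUnionOfSliceDomains Ω) {D : Set ℂ}
    {F : ℂ → Cplx A} (hF : IsMeroStem Ω D F)
    (h : ∀ᶠ z in puncturedNhds Ω, F z * star (F z) = 0) : ∀ᶠ z in puncturedNhds Ω, F z = 0 := by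
  rw [eventually_puncturedNhds] at h ⊢
  rintro z ⟨J, hJ, hz⟩
  obtain ⟨S, hS', rfl⟩ := hU
  obtain ⟨s, hs, hzs⟩ := hz
  obtain ⟨-, D', -, hconn, hc, ⟨r, hr⟩, rfl⟩ := hS' s hs
  have hsub : D' ⊆ shadow (⋃₀ S) := fun w hw =>
    ⟨J, hJ, _, hs, toSlice_mem_circularization_of_mem hJ hw⟩
  have ht : Tendsto (fun t : ℝ => (t : ℂ)) (𝓝[≠] r) (𝓝[≠] (r : ℂ)) := by
    refine tendsto_nhdsWithin_iff.2 ⟨(Complex.continuous_ofReal.tendsto r).mono_left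
      nhdsWithin_le_nhds, ?_⟩
    filter_upwards [self_mem_nhdsWithin] with t ht e
    exact ht (Complex.ofReal_injective e)
  refine eventually_eq_zero_of_frequently hconn.isPreconnected
    (fun w hw => hF.isMeroAt w (hsub hw)) hr (ht.frequently (Eventually.frequently ?_))
    (toSlice_mem_iff hJ hc z hzs)
  -- At a real point the stem function has no `ı`-component, so `F F^c = 0` is an equation in `A`,
  -- where nonsingularity applies.
  filter_upwards [ht.eventually (h _ (hsub hr)), ht.eventually (hF.punctured _ (hsub hr))]
    with t h1 h2
  have him := hF.isStem.im_eq_zero h2 (Complex.ofReal_im t)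
  have hre : (F t).re * star (F t).re = 0 := by simpa [him] using congrArg Cplx.re h1
  exact Cplx.ext (hA _ hre) him

/-- Components of an open planar set are open and partition it, so membership in one is locally
constant. A function constant on each component is thus holomorphic. -/
theorem eventually_mem_connectedComponentIn_iff {U : Set ℂ} (hU : IsOpen U) {z z₀ : ℂ}
    (hz : z ∈ U) :
    ∀ᶠ w in 𝓝 z, (w ∈ connectedComponentIn U z₀ ↔ z ∈ connectedComponentIn U z₀) := by
  filter_upwards [hU.connectedComponentIn.mem_nhds (mem_connectedComponentIn hz)] with w hw
  have key : ∀ v ∈ U, (v ∈ connectedComponentIn U z₀ ↔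
      connectedComponentIn U z₀ = connectedComponentIn U v) := fun v hv =>
    ⟨connectedComponentIn_eq, fun e => e ▸ mem_connectedComponentIn hv⟩
  rw [key w (connectedComponentIn_subset _ _ hw), key z hz, connectedComponentIn_eq hw]

/-- If some component of the shadow does not meet the real line, there is a nonzero holomorphic
stem function with zero norm. -/
theorem exists_isMeroStem_mul_star_eq_zero {J : A} (hJ : J ∈ imagUnits A) {Ω : Set A}
    (ho : IsOpen (shadow Ω)) {z₀ : ℂ} (hz₀ : z₀ ∈ shadow Ω)
    (hreal : ∀ r : ℝ, (r : ℂ) ∉ connectedComponentIn (shadow Ω) z₀) :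
    ∃ F : ℂ → Cplx A, IsMeroStem Ω (shadow Ω) F ∧ (∀ z, F z * star (F z) = 0) ∧
      ∀ z ∈ connectedComponentIn (shadow Ω) z₀, F z ≠ 0 := by
  classical
  set U := shadow Ω with hU
  set C := connectedComponentIn U z₀ with hC
  -- If `C` contained two conjugate points, the imaginary part would vanish somewhere on the
  -- connected set `C`, giving a real point.
  have hdisj : ∀ z ∈ C, star z ∉ C := by
    intro z hz hz'
    have hex : ∃ w ∈ C, w.im = 0 := by
      have hmem : (0 : ℝ) ∈ uIcc z.im (star z).im := by
        rw [show (star z).im = -z.im from rfl, mem_uIcc]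
        rcases le_total 0 z.im with h | h
        · exact Or.inr ⟨by linarith, h⟩
        · exact Or.inl ⟨h, by linarith⟩
      exact (isPreconnected_connectedComponentIn.image Complex.im
        Complex.continuous_im.continuousOn).ordConnected.uIcc_subset
        (mem_image_of_mem _ hz) (mem_image_of_mem _ hz') hmem
    obtain ⟨w, hw, h0⟩ := hex
    refine hreal w.re ?_
    rwa [show (w.re : ℂ) = w from Complex.ext (by simp) (by simp [h0])]
  refine ⟨fun z => if z ∈ C then ⟨1, J⟩ else if star z ∈ C then ⟨1, -J⟩ else 0,
    isMeroStem_of_isHolAt ho ⟨⟨z₀, hz₀⟩, conjInvariant_shadow Ω, fun z _ => ?_⟩ fun z hz => ?_,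
    fun z => ?_, fun z hz => ?_⟩
  · dsimp only
    rw [star_star]
    by_cases h1 : z ∈ C
    · rw [if_neg (hdisj z h1), if_pos h1, if_pos h1]; rfl
    · by_cases h2 : star z ∈ C
      · rw [if_pos h2, if_neg h1, if_pos h2]
        ext <;> simp
      · rw [if_neg h2, if_neg h1, if_neg h1, if_neg h2]
        ext <;> simp
  · refine (isHolAt_const (if z ∈ C then ⟨1, J⟩ else if star z ∈ C then ⟨1, -J⟩ else 0) z).congr ?_
    filter_upwards [eventually_mem_connectedComponentIn_iff (z₀ := z₀) ho hz,
      (continuous_star (R := ℂ)).continuousAt.eventually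
        (eventually_mem_connectedComponentIn_iff (z₀ := z₀) ho (conjInvariant_shadow Ω z hz))]
      with w h1 h2
    simp only [← hC] at h1 h2
    simp only [h1, h2]
  -- `(1 ± ıJ)(1 ∓ ıJ) = 1 + J² = 0`, since `J^c = -J`.
  · dsimp only
    split_ifs
    · ext <;> simp [star_imagUnit hJ, imagUnit_mul_self hJ]
    · ext <;> simp [star_imagUnit hJ, imagUnit_mul_self hJ]
    · simp
  · dsimp only
    rw [if_pos hz]
    exact fun h => one_ne_zero (congrArg Cplx.re h)

theorem isUnionOfSliceDomains_of_real (hS : (imagUnits A).Nonempty) (hN : NormCompatible A)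
    {Ω : Set A} (hΩ : IsCircular Ω) (ho : IsOpen (shadow Ω))
    (h : ∀ z ∈ shadow Ω, ∃ r : ℝ, (r : ℂ) ∈ connectedComponentIn (shadow Ω) z) :
    IsUnionOfSliceDomains Ω := by
  refine ⟨(fun z => circularization (connectedComponentIn (shadow Ω) z)) '' shadow Ω, ?_, ?_⟩
  · rintro _ ⟨z, hz, rfl⟩
    obtain ⟨r, hr⟩ := h z hz
    -- Conjugation fixes the real point `r`, so it maps the component of `r` into itself.
    have hc : ConjInvariant (connectedComponentIn (shadow Ω) z) := by
      intro w hw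
      have hsub : star '' connectedComponentIn (shadow Ω) z ⊆
          connectedComponentIn (shadow Ω) r := by
        refine (isPreconnected_connectedComponentIn.image star
          (continuous_star (R := ℂ)).continuousOn).subset_connectedComponentIn
          ⟨r, hr, Complex.conj_ofReal r⟩ ?_
        rintro _ ⟨v, hv, rfl⟩
        exact conjInvariant_shadow Ω v (connectedComponentIn_subset _ _ hv)
      rw [connectedComponentIn_eq hr]
      exact hsub ⟨w, hw, rfl⟩
    exact ⟨isOpenInCone_circularization hS hN ho.connectedComponentIn hc, _,
      ho.connectedComponentIn, isConnected_connectedComponentIn_iff.2 hz, hc, ⟨r, hr⟩, rfl⟩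
  · ext x
    constructor
    · intro hx
      rw [← hΩ.circularization_shadow] at hx
      obtain ⟨-, z, hz, J, hJ, rfl⟩ := hx
      exact ⟨_, ⟨z, hz, rfl⟩,
        toSlice_mem_circularization_of_mem hJ (mem_connectedComponentIn hz)⟩
    · rintro ⟨_, ⟨z, -, rfl⟩, -, w, hw, J, hJ, rfl⟩
      exact (hΩ.toSlice_mem hJ).2 (connectedComponentIn_subset _ _ hw)

end Nonsingular

end SliceAlg

/-! ### The *-algebra of semiregular functions -/

theorem mainTheorem5 {A : Type*} [NormedNonAssocRing A] [NormedSpace ℝ A] [IsScalarTower ℝ A A]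
    [SMulCommClass ℝ A A] [StarRing A] [StarModule ℝ A] [FiniteDimensional ℝ A] [Nontrivial A]
    (hA : IsAlternative A) (hS : (SliceAlg.imagUnits A).Nonempty)
    (hN : SliceAlg.NormCompatible A)
    (Ω : Set A) (hΩne : Ω.Nonempty) (hΩc : SliceAlg.IsCircular Ω)
    (hΩo : SliceAlg.IsOpenInCone Ω) :
    ∃ (_ : NonAssocRing (SliceAlg.Semiregular Ω)) (_ : Module ℝ (SliceAlg.Semiregular Ω))
      (_ : StarRing (SliceAlg.Semiregular Ω)),
      -- the operations are the expected ones, and all of them preserve semiregularity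
      (∀ f g : SliceAlg.SemiregularRep Ω, ∃ h : SliceAlg.SemiregularRep Ω,
        h.dom = f.dom ∩ g.dom ∧ (∀ x ∈ h.dom, h.toFun x = f.toFun x + g.toFun x) ∧
        f.toSemiregular + g.toSemiregular = h.toSemiregular) ∧
      (∀ f g : SliceAlg.SemiregularRep Ω, ∃ h : SliceAlg.SemiregularRep Ω,
        h.dom = f.dom ∩ g.dom ∧ SliceAlg.IsSliceProduct h.dom f.toFun g.toFun h.toFun ∧
        f.toSemiregular * g.toSemiregular = h.toSemiregular) ∧
      (∀ f : SliceAlg.SemiregularRep Ω, ∃ h : SliceAlg.SemiregularRep Ω,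
        h.dom = f.dom ∧ SliceAlg.IsSliceConj h.dom f.toFun h.toFun ∧
        star f.toSemiregular = h.toSemiregular) ∧
      (∀ (r : ℝ) (f : SliceAlg.SemiregularRep Ω), ∃ h : SliceAlg.SemiregularRep Ω,
        h.dom = f.dom ∧ (∀ x ∈ h.dom, h.toFun x = r • f.toFun x) ∧
        r • f.toSemiregular = h.toSemiregular) ∧
      (∃ e : SliceAlg.SemiregularRep Ω, e.dom = Ω ∧ (∀ x ∈ Ω, e.toFun x = 1) ∧
        (1 : SliceAlg.Semiregular Ω) = e.toSemiregular) ∧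
      -- they form a real alternative algebra with unit `1 ≠ 0`
      IsScalarTower ℝ (SliceAlg.Semiregular Ω) (SliceAlg.Semiregular Ω) ∧
      SMulCommClass ℝ (SliceAlg.Semiregular Ω) (SliceAlg.Semiregular Ω) ∧
      IsAlternative (SliceAlg.Semiregular Ω) ∧
      Nontrivial (SliceAlg.Semiregular Ω) ∧
      -- which is a real *-algebra
      StarModule ℝ (SliceAlg.Semiregular Ω) ∧
      -- nonsingular exactly in the stated case
      (IsNonsingular (SliceAlg.Semiregular Ω) ↔
        IsNonsingular A ∧ SliceAlg.IsUnionOfSliceDomains Ω) := by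
  obtain ⟨J, hJ⟩ := hS
  have ho : IsOpen (SliceAlg.shadow Ω) := hΩo.isOpen_shadow
  have hne : (SliceAlg.shadow Ω).Nonempty := by
    obtain ⟨x, hx⟩ := hΩne
    rw [← hΩc.circularization_shadow] at hx
    obtain ⟨-, z, hz, -⟩ := hx
    exact ⟨z, hz⟩
  -- This makes the germ algebra nontrivial and lets an eventual identity be evaluated at some
  -- point.
  have hbot : (SliceAlg.puncturedNhds Ω).NeBot := by
    obtain ⟨z, hz⟩ := hne
    exact NeBot.mono inferInstance (le_biSup (fun z => 𝓝[≠] z) hz)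
  have hι := SliceAlg.stemGerm_injective hA hN hJ hΩc
  have hcoe := SliceAlg.stemGerm_toSemiregular hA hN hJ hΩc
  have hrep : ∀ x : SliceAlg.Semiregular Ω, ∃ f : SliceAlg.SemiregularRep Ω,
      f.toSemiregular = x := Quotient.exists_rep
  have hmero : ∀ f : SliceAlg.SemiregularRep Ω, _ := fun f => f.isMeroStem hA hN hJ hΩc
  have hind : ∀ f : SliceAlg.SemiregularRep Ω, _ := fun f => f.induces hA hJ
  have hcirc : ∀ f : SliceAlg.SemiregularRep Ω,
      SliceAlg.circularization (SliceAlg.shadow f.dom) = f.dom := fun f =>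
    f.circular.circularization_shadow
  have hinter : ∀ f g : SliceAlg.SemiregularRep Ω,
      SliceAlg.circularization (SliceAlg.shadow f.dom ∩ SliceAlg.shadow g.dom) =
        f.dom ∩ g.dom := fun f g => by
    rw [← SliceAlg.circularization_inter (SliceAlg.conjInvariant_shadow g.dom), hcirc, hcirc]
  have hone := SliceAlg.isMeroStem_const ho hne (1 : A)
  obtain ⟨R, M, T, h1, hadd, hmul, hstar, hsmul⟩ :=
    SliceAlg.exists_starAlgebra_of_injective
      (SliceAlg.stemGerm J : SliceAlg.Semiregular Ω → _) hι
      (by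
        obtain ⟨h, -, -, e⟩ := hone.exists_rep hA hN hJ hΩc
        exact ⟨_, e⟩)
      (fun s t => by
        obtain ⟨f, rfl⟩ := hrep s
        obtain ⟨g, rfl⟩ := hrep t
        obtain ⟨h, -, -, e⟩ := ((hmero f).add (hmero g)).exists_rep hA hN hJ hΩc
        exact ⟨_, by rw [e, hcoe, hcoe]; rfl⟩)
      (fun s t => by
        obtain ⟨f, rfl⟩ := hrep s
        obtain ⟨g, rfl⟩ := hrep t
        obtain ⟨h, -, -, e⟩ := ((hmero f).mul (hmero g)).exists_rep hA hN hJ hΩc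
        exact ⟨_, by rw [e, hcoe, hcoe]; rfl⟩)
      (fun s => by
        obtain ⟨f, rfl⟩ := hrep s
        obtain ⟨h, -, -, e⟩ := (hmero f).star.exists_rep hA hN hJ hΩc
        exact ⟨_, by rw [e, hcoe]; rfl⟩)
      (fun r s => by
        obtain ⟨f, rfl⟩ := hrep s
        obtain ⟨h, -, -, e⟩ := ((hmero f).smul r).exists_rep hA hN hJ hΩc
        exact ⟨_, by rw [e, hcoe]; rfl⟩)
  have h0 : SliceAlg.stemGerm J (0 : SliceAlg.Semiregular Ω) = 0 := by
    rw [← zero_smul ℝ (1 : SliceAlg.Semiregular Ω), hsmul, zero_smul]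
  -- Both necessary conditions follow by testing nonsingularity on an explicit stem function of zero
  -- norm: a constant, and the one supported on a component and its conjugate.
  have hnorm : ∀ {D F}, SliceAlg.IsMeroStem Ω D F → (∀ z, F z * star (F z) = 0) →
      IsNonsingular (SliceAlg.Semiregular Ω) → ∀ᶠ z in SliceAlg.puncturedNhds Ω, F z = 0 := by
    intro D F hF hz hns
    obtain ⟨h, -, -, e⟩ := hF.exists_rep hA hN hJ hΩc
    have hh : h.toSemiregular = 0 := hns _ (hι (by
      rw [hmul, hstar, e, h0]
      exact Germ.coe_eq.2 (Eventually.of_forall hz)))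
    rw [hh, h0] at e
    exact (Germ.coe_eq.1 e).symm
  refine ⟨R, M, T, fun f g => ?_, fun f g => ?_, fun f => ?_, fun r f => ?_, ?_,
    ⟨fun r x y => hι ?_⟩, ⟨fun r x y => hι ?_⟩, fun x y => ⟨hι ?_, hι ?_⟩, ⟨0, 1, fun e => ?_⟩,
    ⟨fun r x => hι ?_⟩, fun hns => ⟨fun a ha => ?_, ?_⟩, fun ⟨hns, hU⟩ x hx => hι ?_⟩
  -- Here and below, identities of classes are checked on germs through the injection `hι`. Since
  -- `f` and `g` are arbitrary representatives, this includes well-definedness.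
  · obtain ⟨h, hd, hi, e⟩ := ((hmero f).add (hmero g)).exists_rep hA hN hJ hΩc
    refine ⟨h, hd.trans (hinter f g), fun x hx => ?_, hι (by rw [hadd, hcoe, hcoe, e]; rfl)⟩
    rw [hd] at hx
    obtain ⟨-, z, hz, K, hK, rfl⟩ := hx
    rw [hi.2.2 z hz K hK, (hind f).2.2 z hz.1 K hK, (hind g).2.2 z hz.2 K hK]
    simp only [SliceAlg.evalAt, SliceAlg.Cplx.re_add, SliceAlg.Cplx.im_add, mul_add]
    abel
  · have hm := (hmero f).mul (hmero g)
    obtain ⟨h, hd, hi, e⟩ := hm.exists_rep hA hN hJ hΩc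
    refine ⟨h, hd.trans (hinter f g), ⟨_, _, _, ?_, ?_, hi⟩, hι (by rw [hmul, hcoe, hcoe, e]; rfl)⟩
    · rw [hd]
      exact (hind f).restrict inter_subset_left hm.isStem.2.1 hm.isStem.1
    · rw [hd]
      exact (hind g).restrict inter_subset_right hm.isStem.2.1 hm.isStem.1
  · obtain ⟨h, hd, hi, e⟩ := (hmero f).star.exists_rep hA hN hJ hΩc
    refine ⟨h, hd.trans (hcirc f), ⟨_, _, ?_, hi⟩, hι (by rw [hstar, hcoe, e]; rfl)⟩
    rw [hd, hcirc]
    exact hind f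
  · obtain ⟨h, hd, hi, e⟩ := ((hmero f).smul r).exists_rep hA hN hJ hΩc
    refine ⟨h, hd.trans (hcirc f), fun x hx => ?_, hι (by rw [hsmul, hcoe, e]; rfl)⟩
    rw [hd] at hx
    obtain ⟨-, z, hz, K, hK, rfl⟩ := hx
    rw [hi.2.2 z hz K hK, (hind f).2.2 z hz K hK]
    simp only [SliceAlg.evalAt, SliceAlg.Cplx.re_smul, SliceAlg.Cplx.im_smul, mul_smul_comm,
      smul_add]
  · obtain ⟨h, hd, hi, e⟩ := hone.exists_rep hA hN hJ hΩc
    rw [hΩc.circularization_shadow] at hd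
    refine ⟨h, hd, fun x hx => ?_, hι (by rw [h1, e]; rfl)⟩
    rw [← hΩc.circularization_shadow] at hx
    obtain ⟨-, z, hz, K, hK, rfl⟩ := hx
    rw [hi.2.2 z hz K hK]
    simp [SliceAlg.evalAt]
  · simp only [smul_eq_mul, hmul, hsmul, SliceAlg.germ_smul_mul]
  · simp only [smul_eq_mul, hmul, hsmul, SliceAlg.germ_mul_smul]
  · have e := (SliceAlg.germ_isAlternative hA (SliceAlg.stemGerm J x) (SliceAlg.stemGerm J y)).1
    rw [associator, sub_eq_zero] at e
    rw [associator, hι (by simpa only [hmul] using e :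
      SliceAlg.stemGerm J (x * x * y) = SliceAlg.stemGerm J (x * (x * y))), sub_self]
  · have e := (SliceAlg.germ_isAlternative hA (SliceAlg.stemGerm J x) (SliceAlg.stemGerm J y)).2
    rw [associator, sub_eq_zero] at e
    rw [associator, hι (by simpa only [hmul] using e :
      SliceAlg.stemGerm J (y * x * x) = SliceAlg.stemGerm J (y * (x * x))), sub_self]
  · have e' := congrArg (SliceAlg.stemGerm J) e
    rw [h0, h1] at e'
    exact zero_ne_one e'
  · simp only [hstar, hsmul, star_trivial, SliceAlg.germ_star_smul]
  · have hF := hnorm (SliceAlg.isMeroStem_const ho hne a)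
      (fun _ => by ext <;> simp [ha]) hns
    obtain ⟨z, hz⟩ := hF.exists
    exact congrArg SliceAlg.Cplx.re hz
  · refine SliceAlg.isUnionOfSliceDomains_of_real ⟨J, hJ⟩ hN hΩc ho fun z hz => ?_
    by_contra! hreal
    obtain ⟨F, hF, hF0, hFne⟩ := SliceAlg.exists_isMeroStem_mul_star_eq_zero hJ ho hz hreal
    have h2 := SliceAlg.eventually_puncturedNhds.1 (hnorm hF hF0 hns) z hz
    obtain ⟨w, hw, hw'⟩ := (h2.and (nhdsWithin_le_nhds
      (ho.connectedComponentIn.mem_nhds (mem_connectedComponentIn hz)))).exists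
    exact hFne w hw' hw
  · obtain ⟨f, rfl⟩ := hrep x
    have e := congrArg (SliceAlg.stemGerm J) hx
    rw [hmul, hstar, h0, hcoe] at e
    rw [hcoe, h0]
    exact Germ.coe_eq.2 (SliceAlg.eventually_eq_zero_of_mul_star hns hU (hmero f)
      (Germ.coe_eq.1 e))
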